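/- For a linear subspace $L\subset\mathbb{R}^4$ put $\Gamma_L=L\cap\mathbb{Z}^4$. Call $L$ rational if the rank of $\Gamma_L$ equals $\dim L$; its height $H(L)$ is then the discriminant of the lattice $\Gamma_L$, that is, $H(L)=\sqrt{\det(\langle v_i,v_j\rangle)}$ for a $\mathbb{Z}$-basis $(v_i)$ of $\Gamma_L$. For two-dimensional subspaces $A,B\subset\mathbb{R}^4$ let $\psi(A,B)\in[0,\pi/2]$ be the minimum of the angles between a unit vector of $A$ and a unit vector of $B$. The plane spanned by $q_1,q_2\in\mathbb{R}^4$ has the homogeneous Plücker coordinates $p_{k,l}=q_{1,k}q_{2,l}-q_{1,l}q_{2,k}$. For each partition $\{1,2,3,4\}=\{i,j\}\cup\{i',j'\}$ with $i<j$, $i'<j'$, and each set $\mathfrak{A}$ of two-dimensional subspaces of $\mathbb{R}^4$, let $\mathcal{A}_{i,j}\subset\mathbb{R}^4$ be the set of all vectors $$(\ell_{1,1},\ell_{1,2},\ell_{2,1},\ell_{2,2})=(-p_{j,i'},\,p_{i,i'},\,-p_{j,j'},\,p_{i,j'}),$$ where $p$ runs over the Plücker coordinates of elements of $\mathfrak{A}$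 that are normalized so that $p_{i,j}=1$ and $|p_{k,l}|\le 1$ for all $k,l$. (Thus the plane is the graph $z_{i'}=\ell_{1,1}z_i+\ell_{1,2}z_j$, $z_{j'}=\ell_{2,1}z_i+\ell_{2,2}z_j$.) A property is said to hold for almost every two-dimensional subspace of $\mathbb{R}^4$ if, for the set $\mathfrak{A}$ of all two-dimensional subspaces that fail to have it, $\mathcal{A}_{i,j}$ has four-dimensional Lebesgue measure $0$ for all $i<j$. **Theorem.** (1) Let $\omega:[1,\infty)\to[0,\infty)$ be monotonically decreasing (not necessarily strictly) with $$\sum_{j=1}^\infty j\,\omega(\sqrt{j})<\infty.$$ Then for almost every two-dimensional subspace $A\subset\mathbb{R}^4$ there is a constant $C(A)>0$ such that $$\psi(A,B)\ge C(A)\,\omega(H(B))\qquad\text{for all rational two-dimensional subspaces } B\subset\mathbb{R}^4.$$ (2) In particular, for every $\varepsilon>0$ and almost every two-dimensional subspace $A\subset\mathbb{R}^4$ there is a constant $C(A,\varepsilon)>0$ such that $$\psi(A,B)\ge C(A,\varepsilon)\,H(B)^{-4-\varepsilon}\qquad\text{for all rational two-dimensional subspaces } B\subset\mathbb{R}^4.$$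 -/

import Mathlib

namespace Planes

/-- The Euclidean space `ℝ^d`. -/
abbrev E (d : ℕ) : Type := EuclideanSpace ℝ (Fin d)

/-! Rational subspaces and their height -/

/-- The lattice `Γ_L = L ∩ ℤ^d` of integer points of a linear subspace `L` of `ℝ^d`. -/
def integerLattice {d : ℕ} (L : Submodule ℝ (E d)) : Submodule ℤ (E d) where
  carrier := {z | z ∈ L ∧ ∀ i, ∃ n : ℤ, z i = n}
  add_mem' := by
    rintro a b ⟨ha, ha'⟩ ⟨hb, hb'⟩
    refine ⟨L.add_mem ha hb, fun i => ?_⟩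
    obtain ⟨m, hm⟩ := ha' i
    obtain ⟨n, hn⟩ := hb' i
    exact ⟨m + n, by simp [hm, hn]⟩
  zero_mem' := ⟨L.zero_mem, fun i => ⟨0, by simp⟩⟩
  smul_mem' := by
    rintro c a ⟨ha, ha'⟩
    refine ⟨L.smul_of_tower_mem c ha, fun i => ?_⟩
    obtain ⟨m, hm⟩ := ha' i
    exact ⟨c * m, by simp [hm]⟩

theorem integerLattice_le {d : ℕ} (L : Submodule ℝ (E d)) :
    integerLattice L ≤ Submodule.span ℤ (Set.range (EuclideanSpace.basisFun (Fin d) ℝ)) := by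
  rintro z ⟨-, hz⟩
  choose n hn using hz
  have h : z = ∑ i, n i • EuclideanSpace.basisFun (Fin d) ℝ i := by
    ext j
    simp [Finset.sum_apply, hn, Pi.single_apply]
  rw [h]
  exact Submodule.sum_mem _ fun i _ =>
    Submodule.smul_mem _ _ (Submodule.subset_span ⟨i, rfl⟩)

instance integerLattice_finite {d : ℕ} (L : Submodule ℝ (E d)) :
    Module.Finite ℤ (integerLattice L) := by
  have : Module.Finite ℤ
      (Submodule.span ℤ (Set.range (EuclideanSpace.basisFun (Fin d) ℝ))) :=
    Module.Finite.span_of_finite ℤ (Set.finite_range _)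
  exact Module.Finite.of_injective (Submodule.inclusion (integerLattice_le L))
    (Submodule.inclusion_injective _)

instance integerLattice_free {d : ℕ} (L : Submodule ℝ (E d)) :
    Module.Free ℤ (integerLattice L) := by
  have : Module.IsTorsionFree ℤ (integerLattice L) :=
    Function.Injective.moduleIsTorsionFree (N := Fin d → ℝ) (fun z => WithLp.ofLp (z : E d))
      ((WithLp.ofLp_injective 2).comp Subtype.val_injective) (fun r m => rfl)
  exact Module.free_of_finite_type_torsion_free'

/-- `L` is rational if the rank of `Γ_L` equals the dimension of `L`. -/
def IsRational {d : ℕ} (L : Submodule ℝ (E d)) : Prop :=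
  Module.finrank ℤ (integerLattice L) = Module.finrank ℝ L

/-- The height `H(L)`: the discriminant (determinant) of the lattice `Γ_L`, that is, the square
root of the Gram determinant of a `ℤ`-basis of `Γ_L`. -/
noncomputable def height {d : ℕ} (L : Submodule ℝ (E d)) : ℝ :=
  Real.sqrt (Matrix.gram ℝ
    (fun i => (Module.finBasis ℤ (integerLattice L) i : E d))).det

/-- The Gram determinants of two `ℤ`-bases of `Γ_L` agree. -/
theorem gram_det_eq {d : ℕ} (L : Submodule ℝ (E d)) {ι : Type*} [Fintype ι] [DecidableEq ι]
    (b c : Module.Basis ι ℤ (integerLattice L)) :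
    (Matrix.gram ℝ (fun i => (b i : E d))).det = (Matrix.gram ℝ (fun i => (c i : E d))).det := by
  set P : Matrix ι ι ℤ := c.toMatrix b with hP
  have hb : ∀ i, (b i : E d) = ∑ k, (P k i : ℝ) • (c k : E d) := by
    intro i
    have h := congrArg (Subtype.val : integerLattice L → E d) (c.sum_toMatrix_smul_self b i)
    rw [← h]
    simp only [Submodule.coe_sum, Submodule.coe_smul_of_tower, hP]
    exact Finset.sum_congr rfl fun k _ => (Int.cast_smul_eq_zsmul ℝ _ _).symm
  have hG : Matrix.gram ℝ (fun i => (b i : E d)) =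
      (P.map (Int.castRingHom ℝ)).transpose * Matrix.gram ℝ (fun i => (c i : E d)) *
        P.map (Int.castRingHom ℝ) := by
    ext i j
    simp only [Matrix.gram_apply, Matrix.mul_apply, Matrix.transpose_apply, Matrix.map_apply,
      hb, sum_inner, inner_sum, real_inner_smul_left, real_inner_smul_right, Finset.sum_mul,
      eq_intCast]
    exact Finset.sum_congr rfl fun k _ => Finset.sum_congr rfl fun l _ => by ring
  have hdet : (P.map (Int.castRingHom ℝ)).det * (P.map (Int.castRingHom ℝ)).det = 1 := by
    have hu : IsUnit P.det := by
      have h1 : P * b.toMatrix c = 1 := c.toMatrix_mul_toMatrix_flip b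
      exact IsUnit.of_mul_eq_one (b.toMatrix c).det (by rw [← Matrix.det_mul, h1, Matrix.det_one])
    have h2 : P.det * P.det = 1 := Int.isUnit_mul_self hu
    have h3 : (P.map (Int.castRingHom ℝ)).det = ((P.det : ℤ) : ℝ) :=
      (RingHom.map_det (Int.castRingHom ℝ) P).symm
    rw [h3]
    exact_mod_cast h2
  rw [hG, Matrix.det_mul, Matrix.det_mul, Matrix.det_transpose]
  linear_combination (Matrix.gram ℝ (fun i => (c i : E d))).det * hdet

/-- The height does not depend on the chosen `ℤ`-basis of `Γ_L`. -/
theorem height_eq {d : ℕ} (L : Submodule ℝ (E d)) {ι : Type*} [Fintype ι] [DecidableEq ι]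
    (b : Module.Basis ι ℤ (integerLattice L)) :
    height L = Real.sqrt (Matrix.gram ℝ (fun i => (b i : E d))).det := by
  set c := Module.finBasis ℤ (integerLattice L) with hc
  set e := c.indexEquiv b with he
  have h := gram_det_eq L b (c.reindex e)
  rw [h, height]
  congr 1
  rw [← Matrix.det_submatrix_equiv_self e.symm]
  congr 1
  ext i j
  simp [Matrix.gram_apply, hc]

/-! The angle between subspaces -/

/-- `ψ(L₁, L₂)`: the minimum of the angles between unit vectors of `L₁` and unit vectors
of `L₂`. -/
noncomputable def minAngle {d : ℕ} (L₁ L₂ : Submodule ℝ (E d)) : ℝ :=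
  sInf {θ : ℝ | ∃ w ∈ L₁, ∃ z ∈ L₂, ‖w‖ = 1 ∧ ‖z‖ = 1 ∧ θ = InnerProductGeometry.angle w z}

/-! Pluecker coordinates and the affine charts; the indices `1, 2, 3, 4` are written
`0, 1, 2, 3`. A point of `ℝ^6` with coordinates `p_{k,l}`, `k < l`, is written as an antisymmetric
array `p : Fin 4 → Fin 4 → ℝ`. -/

/-- The `2 × 2` minors `p_{k,l}` of the matrix with rows `q₁`, `q₂`. -/
def minors (q₁ q₂ : E 4) (k l : Fin 4) : ℝ := q₁ k * q₂ l - q₁ l * q₂ k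

/-- `p` is a vector of (homogeneous) Pluecker coordinates of the plane `L`: it is the array of
minors of some basis of `L`. The vectors obtained from the various bases are exactly the nonzero
multiples of any one of them. -/
def IsPluckerVector (L : Submodule ℝ (E 4)) (p : Fin 4 → Fin 4 → ℝ) : Prop :=
  ∃ q₁ q₂ : E 4, LinearIndependent ℝ ![q₁, q₂] ∧ Submodule.span ℝ {q₁, q₂} = L ∧
    p = minors q₁ q₂

/-- The part `W_{i,j}` of the cone over the Grassmannian in the affine space `p_{i,j} = 1`
where all coordinates have absolute value at most `1`. -/
def W (i j : Fin 4) : Set (Fin 4 → Fin 4 → ℝ) :=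
  {p | (∀ k l, p l k = -p k l) ∧ p i j = 1 ∧ (∀ k l, |p k l| ≤ 1) ∧
    p 0 1 * p 2 3 - p 0 2 * p 1 3 + p 0 3 * p 1 2 = 0}

/-- The affine chart `ν_{i,j}`, `p ↦ (ℓ₁₁, ℓ₁₂, ℓ₂₁, ℓ₂₂)`, where
`(i, j, i', j') = (σ 0, σ 1, σ 2, σ 3)` is a permutation of the four indices:
`p_{i,i'} = ℓ₁₂`, `p_{i,j'} = ℓ₂₂`, `p_{j,i'} = -ℓ₁₁`, `p_{j,j'} = -ℓ₂₁`. -/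
def nu (σ : Equiv.Perm (Fin 4)) (p : Fin 4 → Fin 4 → ℝ) : Fin 4 → ℝ :=
  ![-p (σ 1) (σ 2), p (σ 0) (σ 2), -p (σ 1) (σ 3), p (σ 0) (σ 3)]

/-- The image in `ℝ^4`, under the chart `ν_{i,j}`, of the points of `W_{i,j}` that represent
planes of the set `𝔄`. -/
def chartImage (σ : Equiv.Perm (Fin 4)) (𝔄 : Set (Submodule ℝ (E 4))) : Set (Fin 4 → ℝ) :=
  nu σ '' {p | p ∈ W (σ 0) (σ 1) ∧ ∃ L ∈ 𝔄, IsPluckerVector L p}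

/-- A property holds for almost every plane in `ℝ^4` if the exceptional set of planes has
an image of Lebesgue measure zero in each of the six charts `i < j` (with the complementary
indices `i' < j'` in increasing order). -/
def AlmostEveryPlane (P : Submodule ℝ (E 4) → Prop) : Prop :=
  ∀ σ : Equiv.Perm (Fin 4), σ 0 < σ 1 → σ 2 < σ 3 →
    MeasureTheory.volume
      (chartImage σ {A : Submodule ℝ (E 4) | Module.finrank ℝ A = 2 ∧ ¬ P A}) = 0

end Planes

/-!
The theorem is a Borel–Cantelli statement. Three estimates carry it.

*Angles and wedge products.* For planes `A`, `B` with Pluecker vectors `p`, `P`, the wedge product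
`klein p P` vanishes exactly when the planes meet nontrivially, and the angle satisfies
`ψ(A, B) ≥ c |klein p P| / |P|` as long as `p` is bounded (`abs_klein_le_minAngle`). If `B` is
rational, the minors of a basis of the lattice `Γ_B` form a nonzero integer Pluecker vector `P` of
Euclidean norm `H(B)` (`exists_pair_of_isRational`). It therefore suffices to bound
`|klein p P|` from below by a multiple of `ω(|P|) |P|` for all nonzero integer points `P` of the
Pluecker quadric; neither primitivity of `P` nor its correspondence with planes matters.

*Volume.* In a chart of the Grassmannian, `klein · P` is a polynomial `chartForm` of the form
"constant plus linear plus a multiple of the determinant" whose coefficient vector has length `|P|`.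
The part of the cube `[-1, 1]^4` where such a form is smaller than `δ |P|` has volume `O(δ)`,
uniformly in `P` (`exists_volume_detForm_lt_le`). The quadratic term is harmless because a
determinant has a gradient that vanishes only at a point, and `1 / |x|` is integrable in the plane.

*Counting.* The Pluecker quadric has `O(X^4)` integer points of height at most `X`
(`card_orthogonalPairs_le`). Writing the points as pairs `(u, v)` of orthogonal vectors of `ℤ³`,
the number of `v` for a given `u` is `O(X² gcd(u) / |u| + X)`, and the average of the gcd is
bounded.

Hence the points of the chart at which some `P` of norm in `[2^k, 2^(k+1))` violates the bound
fill a volume `O(16^k ω(2^k))`, and the sum of these volumes is finite by condensation of the series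
`∑ j ω(√j)`. So almost every point is bad for finitely many `k` only, which leaves finitely many
`P`, and for those `klein p P` does not vanish, again outside a null set.
-/

/-! ### Volume of the set where a determinantal form is small -/

namespace Planes

open MeasureTheory Set
open scoped ENNReal

/-- Fubini's theorem for a product of functions of the single coordinates. -/
theorem lintegral_fin_prod_eq_prod {n : ℕ} (f : Fin n → ℝ → ℝ≥0∞) (hf : ∀ i, Measurable (f i)) :
    ∫⁻ y : Fin n → ℝ, ∏ i, f i (y i) = ∏ i, ∫⁻ t, f i t := by
  have hm : ∀ {m : ℕ} (h : Fin m → ℝ → ℝ≥0∞), (∀ i, Measurable (h i)) →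
      Measurable fun y : Fin m → ℝ => ∏ i, h i (y i) := fun h hh =>
    Finset.measurable_prod _ fun i _ => (hh i).comp (measurable_pi_apply i)
  induction n with
  | zero => simp [volume_pi]
  | succ n ih =>
    rw [← ((volume_preserving_piFinSuccAbove (fun _ : Fin (n + 1) => ℝ) 0).symm).lintegral_comp
      (hm f hf),
      Fin.prod_univ_succ, ← ih _ fun i => hf i.succ, Measure.volume_eq_prod,
      ← lintegral_prod_mul (hf 0).aemeasurable
        (hm _ fun i => hf (Fin.succ i)).aemeasurable]
    refine lintegral_congr fun z => ?_
    rw [Fin.prod_univ_succ]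
    rfl

/-- A bound for the volume of a set from bounds for its slices in the direction of the coordinate
`i`. -/
theorem volume_le_lintegral_of_slices {n : ℕ} (i : Fin (n + 1)) {S : Set (Fin (n + 1) → ℝ)}
    (hS : MeasurableSet S) {g : (Fin n → ℝ) → ℝ≥0∞}
    (h : ∀ y : Fin n → ℝ, volume {t : ℝ | i.insertNth (α := fun _ => ℝ) t y ∈ S} ≤ g y) :
    volume S ≤ ∫⁻ y, g y := by
  have hm := (volume_preserving_piFinSuccAbove (fun _ : Fin (n + 1) => ℝ) i).symm
  rw [← hm.measure_preimage hS.nullMeasurableSet, Measure.volume_eq_prod,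
    Measure.prod_apply_symm (hm.measurable hS)]
  exact lintegral_mono fun y => h y

theorem volume_abs_affine_lt_le (r s η : ℝ) (hs : s ≠ 0) :
    volume {t : ℝ | |r + s * t| < η} ≤ ENNReal.ofReal (2 * η / |s|) := by
  have hs' := abs_pos.2 hs
  have : {t : ℝ | |r + s * t| < η} = Metric.ball (-r / s) (η / |s|) := by
    ext t
    rw [Metric.mem_ball, Real.dist_eq, lt_div_iff₀ hs', mem_ofPred_eq, ← abs_mul]
    rw [show (t - -r / s) * s = r + s * t by field_simp; ring]
  rw [this, Real.volume_ball, mul_div_assoc]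

/-- The function `x ↦ |x + α|^(-1/2)` with values in `[0, ∞]`; its value at `-α` is `∞`,
so that `1 / max(|u|, |v|) ≤ |u|^(-1/2) |v|^(-1/2)` stays true when `u` or `v` vanishes. -/
noncomputable def invSqrt (α x : ℝ) : ℝ≥0∞ := ENNReal.ofReal |x + α| ^ (-(1 / 2) : ℝ)

theorem measurable_invSqrt (α : ℝ) : Measurable (invSqrt α) := by
  unfold invSqrt
  fun_prop

theorem lintegral_invSqrt_zero_lt_top : ∫⁻ x in Icc (-1) 1, invSqrt 0 x < ∞ := by
  have h1 : ∫⁻ x in Ioc 0 1, invSqrt 0 x < ∞ := by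
    have hi : IntegrableOn (fun x : ℝ => x ^ (-(1 / 2) : ℝ)) (Ioc 0 1) :=
      (intervalIntegrable_iff_integrableOn_Ioc_of_le zero_le_one).1
        (intervalIntegral.intervalIntegrable_rpow' (by norm_num))
    refine lt_of_le_of_lt (le_of_eq ?_) hi.lintegral_lt_top
    refine setLIntegral_congr_fun measurableSet_Ioc fun x hx => ?_
    simp only [invSqrt, add_zero, abs_of_pos hx.1]
    exact ENNReal.ofReal_rpow_of_pos hx.1
  have h1' : ∫⁻ x in Icc 0 1, invSqrt 0 x < ∞ := by
    rwa [setLIntegral_congr Ioc_ae_eq_Icc.symm]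
  have h2 : ∫⁻ x in Icc (-1) 0, invSqrt 0 x = ∫⁻ x in Icc 0 1, invSqrt 0 x := by
    rw [← lintegral_indicator measurableSet_Icc, ← lintegral_indicator measurableSet_Icc,
      ← lintegral_neg_eq_self]
    congr 1 with x
    by_cases hx : x ∈ Icc (0 : ℝ) 1
    · rw [indicator_of_mem hx, indicator_of_mem (by constructor <;> linarith [hx.1, hx.2])]
      simp [invSqrt]
    · rw [indicator_of_notMem hx, indicator_of_notMem]
      exact fun h => hx (by constructor <;> linarith [h.1, h.2])
  rw [← Icc_union_Icc_eq_Icc (show (-1 : ℝ) ≤ 0 by norm_num) zero_le_one]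
  refine lt_of_le_of_lt (lintegral_union_le _ _ _) ?_
  rw [h2]
  exact ENNReal.add_lt_top.2 ⟨h1', h1'⟩

/-- The integrals of the translates of `|x|^(-1/2)` over `[-1, 1]` are uniformly bounded. -/
theorem exists_lintegral_invSqrt_le :
    ∃ K : ℝ≥0∞, K ≠ ∞ ∧ ∀ α, ∫⁻ x in Icc (-1) 1, invSqrt α x ≤ K := by
  refine ⟨2 + ∫⁻ x in Icc (-1) 1, invSqrt 0 x,
    (ENNReal.add_lt_top.2 ⟨by simp, lintegral_invSqrt_zero_lt_top⟩).ne, fun α => ?_⟩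
  calc ∫⁻ x in Icc (-1) 1, invSqrt α x
      ≤ ∫⁻ x in Icc (-1) 1, (1 + (Icc (-1) 1).indicator (invSqrt 0) (x + α)) := by
        refine lintegral_mono fun x => ?_
        by_cases hx : x + α ∈ Icc (-1 : ℝ) 1
        · rw [indicator_of_mem hx]
          simp [invSqrt]
        · rw [indicator_of_notMem hx, add_zero, invSqrt, ENNReal.rpow_neg, ENNReal.inv_le_one]
          refine ENNReal.one_le_rpow ?_ (by norm_num)
          rw [ENNReal.one_le_ofReal]
          by_contra h
          exact hx (abs_le.1 (not_le.1 h).le)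
    _ = 2 + ∫⁻ x in Icc (-1) 1, (Icc (-1) 1).indicator (invSqrt 0) (x + α) := by
        rw [lintegral_add_left measurable_const]
        simp
        norm_num
    _ ≤ 2 + ∫⁻ x, (Icc (-1) 1).indicator (invSqrt 0) (x + α) := by
        gcongr
        exact Measure.restrict_le_self
    _ = 2 + ∫⁻ x in Icc (-1) 1, invSqrt 0 x := by
        rw [lintegral_add_right_eq_self, lintegral_indicator measurableSet_Icc]

/-- The cube `[-1, 1]^n`. -/
def cube (n : ℕ) : Set (Fin n → ℝ) := univ.pi fun _ => Icc (-1) 1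

theorem measurableSet_cube (n : ℕ) : MeasurableSet (cube n) :=
  MeasurableSet.univ_pi fun _ => measurableSet_Icc

theorem volume_cube (n : ℕ) : volume (cube n) = 2 ^ n := by
  rw [cube, volume_pi_pi]
  norm_num

/-- A polynomial in the entries of the matrix `!![x 0, x 1; x 2, x 3]` whose quadratic part is a
multiple of the determinant: in an affine chart of the Grassmannian, the condition that a plane
meets a given plane is the vanishing of such a form. -/
def detForm (e c : ℝ) (a x : Fin 4 → ℝ) : ℝ :=
  e + (a 0 * x 0 + a 1 * x 1 + a 2 * x 2 + a 3 * x 3) + c * (x 0 * x 3 - x 1 * x 2)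

theorem measurable_detForm (e c : ℝ) (a : Fin 4 → ℝ) : Measurable (detForm e c a) := by
  unfold detForm
  fun_prop

theorem insertNth_mem_cube {i : Fin 4} {t : ℝ} {y : Fin 3 → ℝ}
    (h : i.insertNth (α := fun _ => ℝ) t y ∈ cube 4) : y ∈ cube 3 := fun j _ => by
  simpa using h (i.succAbove j) trivial

/-- One-variable slicing: if the slope of the form in one variable is bounded below, the form is
small only on a set of small volume. -/
theorem volume_detForm_lt_le_of_slope {e c : ℝ} {a : Fin 4 → ℝ} {s η : ℝ} (hs : 0 < s) (i : Fin 4)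
    (h : s + |c| ≤ |a i|) :
    volume {x ∈ cube 4 | |detForm e c a x| < η} ≤ 8 * ENNReal.ofReal (2 * η / s) := by
  have hS : MeasurableSet {x ∈ cube 4 | |detForm e c a x| < η} :=
    (measurableSet_cube 4).inter (measurableSet_lt (measurable_detForm e c a).abs measurable_const)
  have key : ∀ y ∈ cube 3, ∃ r b : ℝ, s ≤ |b| ∧
      ∀ t, detForm e c a (i.insertNth (α := fun _ => ℝ) t y) = r + b * t := by
    intro y hy
    have hb : ∀ j, ∀ b : ℝ, b = a i + c * y j ∨ b = a i - c * y j → s ≤ |b| := by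
      intro j b hb
      have hcy : |c * y j| ≤ |c| := by
        rw [abs_mul]
        exact mul_le_of_le_one_right (abs_nonneg c) (abs_le.2 (hy j trivial))
      rcases hb with rfl | rfl
      · have := abs_sub_abs_le_abs_sub (a i) (-(c * y j))
        rw [abs_neg, sub_neg_eq_add] at this
        linarith
      · have := abs_sub_abs_le_abs_sub (a i) (c * y j)
        linarith
    fin_cases i
    · refine ⟨e + (a 1 * y 0 + a 2 * y 1 + a 3 * y 2) - c * (y 0 * y 1), a 0 + c * y 2,
        hb 2 _ (Or.inl rfl), fun t => ?_⟩
      change e + (a 0 * t + a 1 * y 0 + a 2 * y 1 + a 3 * y 2) + c * (t * y 2 - y 0 * y 1) = _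
      ring
    · refine ⟨e + (a 0 * y 0 + a 2 * y 1 + a 3 * y 2) + c * (y 0 * y 2), a 1 - c * y 1,
        hb 1 _ (Or.inr rfl), fun t => ?_⟩
      change e + (a 0 * y 0 + a 1 * t + a 2 * y 1 + a 3 * y 2) + c * (y 0 * y 2 - t * y 1) = _
      ring
    · refine ⟨e + (a 0 * y 0 + a 1 * y 1 + a 3 * y 2) + c * (y 0 * y 2), a 2 - c * y 1,
        hb 1 _ (Or.inr rfl), fun t => ?_⟩
      change e + (a 0 * y 0 + a 1 * y 1 + a 2 * t + a 3 * y 2) + c * (y 0 * y 2 - y 1 * t) = _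
      ring
    · refine ⟨e + (a 0 * y 0 + a 1 * y 1 + a 2 * y 2) - c * (y 1 * y 2), a 3 + c * y 0,
        hb 0 _ (Or.inl rfl), fun t => ?_⟩
      change e + (a 0 * y 0 + a 1 * y 1 + a 2 * y 2 + a 3 * t) + c * (y 0 * t - y 1 * y 2) = _
      ring
  refine (volume_le_lintegral_of_slices i hS
    (g := (cube 3).indicator fun _ => ENNReal.ofReal (2 * η / s)) fun y => ?_).trans ?_
  · by_cases hy : y ∈ cube 3
    · obtain ⟨r, b, hb, hr⟩ := key y hy
      rw [indicator_of_mem hy]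
      have hb0 : b ≠ 0 := by
        rintro rfl
        rw [abs_zero] at hb
        linarith
      rcases lt_or_ge η 0 with hη | hη
      · refine (measure_mono_null (t := ∅) ?_ measure_empty).le.trans zero_le
        rintro t ⟨-, ht⟩
        exact (lt_irrefl _ ((abs_nonneg _).trans_lt (ht.trans hη))).elim
      refine (measure_mono ?_).trans ((volume_abs_affine_lt_le r b η hb0).trans ?_)
      · rintro t ⟨-, ht⟩
        rwa [hr] at ht
      · gcongr
    · refine (measure_mono_null (t := ∅) ?_ measure_empty).le.trans zero_le
      rintro t ⟨ht, -⟩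
      exact hy (insertNth_mem_cube ht)
  · rw [lintegral_indicator (measurableSet_cube 3), setLIntegral_const, volume_cube, mul_comm]
    norm_num

/-- If the quadratic term is not negligible, the slopes in the variables `x 0` and `x 1` are
`c * (x 3 + α)` and `-c * (x 2 + β)`. Slicing in the direction of the larger slope bounds the volume
by the integral of `η / (|c| * max(|x 3 + α|, |x 2 + β|))`, which converges because the singularity
is a point of the plane. Slicing in a single fixed direction would lose a logarithm. -/
theorem volume_detForm_lt_le_of_quadratic :
    ∃ K : ℝ≥0∞, K ≠ ∞ ∧ ∀ (e c : ℝ) (a : Fin 4 → ℝ) (η : ℝ), c ≠ 0 →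
      volume {x ∈ cube 4 | |detForm e c a x| < η} ≤ K * ENNReal.ofReal (η / |c|) := by
  obtain ⟨J, hJ, hJ'⟩ := exists_lintegral_invSqrt_le
  refine ⟨8 * J ^ 2, ENNReal.mul_ne_top (by simp) (ENNReal.pow_ne_top hJ), ?_⟩
  intro e c a η hc
  set α := a 0 / c with hα
  set β := -a 1 / c with hβ
  have hc' := abs_pos.2 hc
  have hs0 : ∀ z, a 0 + c * z = c * (z + α) := fun z => by rw [hα]; field_simp; ring
  have hs1 : ∀ z, a 1 - c * z = -c * (z + β) := fun z => by rw [hβ]; field_simp; ring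
  rcases le_or_gt η 0 with hη | hη
  · refine (measure_mono_null (t := ∅) ?_ measure_empty).le.trans zero_le
    rintro t ⟨-, ht⟩
    exact (lt_irrefl _ ((abs_nonneg _).trans_lt (ht.trans_le hη))).elim
  -- The dominating function: `1 / max(|u|, |v|) ≤ |u|^(-1/2) |v|^(-1/2)` separates the variables.
  set f : Fin 3 → ℝ → ℝ≥0∞ := ![fun _ => 1, invSqrt β, invSqrt α] with hf
  have hfm : ∀ i, Measurable ((Icc (-1) 1).indicator (f i)) := by
    intro i
    refine Measurable.indicator ?_ measurableSet_Icc
    fin_cases i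
    · exact measurable_const
    · exact measurable_invSqrt β
    · exact measurable_invSqrt α
  set g : (Fin 3 → ℝ) → ℝ≥0∞ := fun y =>
    ENNReal.ofReal (2 * (η / |c|)) * ∏ i, (Icc (-1) 1).indicator (f i) (y i) with hg
  have hgint : ∫⁻ y, g y ≤ 4 * J ^ 2 * ENNReal.ofReal (η / |c|) := by
    have hm : Measurable fun y : Fin 3 → ℝ => ∏ i, (Icc (-1) 1).indicator (f i) (y i) :=
      Finset.measurable_prod _ fun i _ => (hfm i).comp (measurable_pi_apply i)
    rw [hg, lintegral_const_mul _ hm, lintegral_fin_prod_eq_prod _ hfm, Fin.prod_univ_three]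
    simp only [lintegral_indicator measurableSet_Icc, hf, Matrix.cons_val_zero,
      Matrix.cons_val_one, Matrix.cons_val]
    have h0 : ∫⁻ _ in Icc (-1 : ℝ) 1, (1 : ℝ≥0∞) = 2 := by simp; norm_num
    rw [h0, ENNReal.ofReal_mul zero_le_two, ENNReal.ofReal_ofNat]
    calc 2 * ENNReal.ofReal (η / |c|) *
          (2 * (∫⁻ x in Icc (-1) 1, invSqrt β x) * ∫⁻ x in Icc (-1) 1, invSqrt α x)
        ≤ 2 * ENNReal.ofReal (η / |c|) * (2 * J * J) := by
          gcongr <;> apply hJ'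
      _ = 4 * J ^ 2 * ENNReal.ofReal (η / |c|) := by ring
  -- The slice estimate, for a slope `k * p` that dominates `k * q`.
  have slice : ∀ (r k p q : ℝ), |k| = |c| → |q| ≤ |p| →
      volume {t : ℝ | |r + k * p * t| < η} ≤ ENNReal.ofReal (2 * (η / |c|)) *
        (ENNReal.ofReal |q| ^ (-(1 / 2) : ℝ) * ENNReal.ofReal |p| ^ (-(1 / 2) : ℝ)) := by
    intro r k p q hk hqp
    have hcoef : ENNReal.ofReal (2 * (η / |c|)) ≠ 0 := by
      rw [ENNReal.ofReal_ne_zero_iff]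
      positivity
    rcases eq_or_ne q 0 with rfl | hq
    · have : ENNReal.ofReal |(0 : ℝ)| ^ (-(1 / 2) : ℝ) = ∞ := by
        rw [abs_zero, ENNReal.ofReal_zero, ENNReal.zero_rpow_of_neg (by norm_num)]
      rw [this, ENNReal.top_mul, ENNReal.mul_top hcoef]
      · exact le_top
      · simp [ENNReal.rpow_eq_zero_iff]
    · have hq' := abs_pos.2 hq
      have hp' := hq'.trans_le hqp
      have hk' : k ≠ 0 := abs_pos.1 (hk ▸ hc')
      refine (volume_abs_affine_lt_le r (k * p) η (mul_ne_zero hk' (abs_pos.1 hp'))).trans ?_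
      rw [ENNReal.ofReal_rpow_of_pos hq', ENNReal.ofReal_rpow_of_pos hp', ← ENNReal.ofReal_mul
        (by positivity), ← ENNReal.ofReal_mul (by positivity)]
      apply ENNReal.ofReal_le_ofReal
      have h1 : |p| ^ (-(1 / 2) : ℝ) ≤ |q| ^ (-(1 / 2) : ℝ) :=
        Real.rpow_le_rpow_of_nonpos hq' hqp (by norm_num)
      have h2 : |p|⁻¹ = |p| ^ (-(1 / 2) : ℝ) * |p| ^ (-(1 / 2) : ℝ) := by
        rw [← Real.rpow_add hp', ← Real.rpow_neg_one]
        norm_num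
      calc 2 * η / |k * p| = 2 * (η / |c|) * |p|⁻¹ := by
            rw [abs_mul, hk]
            field_simp
        _ ≤ _ := by
            rw [h2]
            gcongr
  have mem3 : ∀ y : Fin 3 → ℝ, y ∈ cube 3 → g y = ENNReal.ofReal (2 * (η / |c|)) *
      (invSqrt β (y 1) * invSqrt α (y 2)) := by
    intro y hy
    simp only [hg, Fin.prod_univ_three]
    rw [indicator_of_mem (hy 0 trivial), indicator_of_mem (hy 1 trivial),
      indicator_of_mem (hy 2 trivial)]
    simp [hf]
  set S0 := {x ∈ cube 4 | |detForm e c a x| < η} ∩ {x | |x 2 + β| ≤ |x 3 + α|} with hS0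
  set S1 := {x ∈ cube 4 | |detForm e c a x| < η} ∩ {x | |x 3 + α| ≤ |x 2 + β|} with hS1
  have hS : MeasurableSet {x ∈ cube 4 | |detForm e c a x| < η} :=
    (measurableSet_cube 4).inter (measurableSet_lt (measurable_detForm e c a).abs measurable_const)
  have hm0 : MeasurableSet S0 := hS.inter (measurableSet_le (by fun_prop) (by fun_prop))
  have hm1 : MeasurableSet S1 := hS.inter (measurableSet_le (by fun_prop) (by fun_prop))
  have hv0 : volume S0 ≤ ∫⁻ y, g y := by
    refine volume_le_lintegral_of_slices 0 hm0 fun y => ?_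
    by_cases hy : y ∈ cube 3 ∧ |y 1 + β| ≤ |y 2 + α|
    · rw [mem3 y hy.1]
      refine (measure_mono ?_).trans
        (slice (e + (a 1 * y 0 + a 2 * y 1 + a 3 * y 2) - c * (y 0 * y 1)) c (y 2 + α) (y 1 + β)
          rfl hy.2)
      rintro t ⟨⟨-, ht⟩, -⟩
      change |e + (a 0 * t + a 1 * y 0 + a 2 * y 1 + a 3 * y 2) + c * (t * y 2 - y 0 * y 1)| < η
        at ht
      rw [mem_ofPred_eq, ← hs0]
      convert ht using 2
      ring
    · refine (measure_mono_null (t := ∅) ?_ measure_empty).le.trans zero_le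
      rintro t ⟨⟨ht, -⟩, ht'⟩
      exact hy ⟨insertNth_mem_cube ht, ht'⟩
  have hv1 : volume S1 ≤ ∫⁻ y, g y := by
    refine volume_le_lintegral_of_slices 1 hm1 fun y => ?_
    by_cases hy : y ∈ cube 3 ∧ |y 2 + α| ≤ |y 1 + β|
    · rw [mem3 y hy.1, mul_comm (invSqrt β _)]
      refine (measure_mono ?_).trans
        (slice (e + (a 0 * y 0 + a 2 * y 1 + a 3 * y 2) + c * (y 0 * y 2)) (-c) (y 1 + β)
          (y 2 + α) (abs_neg c) hy.2)
      rintro t ⟨⟨-, ht⟩, -⟩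
      change |e + (a 0 * y 0 + a 1 * t + a 2 * y 1 + a 3 * y 2) + c * (y 0 * y 2 - t * y 1)| < η
        at ht
      rw [mem_ofPred_eq, ← hs1]
      convert ht using 2
      ring
    · refine (measure_mono_null (t := ∅) ?_ measure_empty).le.trans zero_le
      rintro t ⟨⟨ht, -⟩, ht'⟩
      exact hy ⟨insertNth_mem_cube ht, ht'⟩
  calc volume {x ∈ cube 4 | |detForm e c a x| < η} ≤ volume (S0 ∪ S1) := by
        refine measure_mono fun x hx => ?_
        rcases le_total |x 2 + β| |x 3 + α| with h | h
        · exact Or.inl ⟨hx, h⟩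
        · exact Or.inr ⟨hx, h⟩
    _ ≤ volume S0 + volume S1 := measure_union_le _ _
    _ ≤ 4 * J ^ 2 * ENNReal.ofReal (η / |c|) + 4 * J ^ 2 * ENNReal.ofReal (η / |c|) :=
        add_le_add (hv0.trans hgint) (hv1.trans hgint)
    _ = 8 * J ^ 2 * ENNReal.ofReal (η / |c|) := by ring

/-- The set of points of the cube where a form with coefficient vector of length `N` is less than
`δ * N` has volume `O(δ)`, uniformly in the form. -/
theorem exists_volume_detForm_lt_le :
    ∃ K : ℝ≥0∞, K ≠ ∞ ∧ ∀ (e c : ℝ) (a : Fin 4 → ℝ) (N δ : ℝ), 0 < N → 0 ≤ δ →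
      N ^ 2 = e ^ 2 + (a 0 ^ 2 + a 1 ^ 2 + a 2 ^ 2 + a 3 ^ 2) + c ^ 2 →
      volume {x ∈ cube 4 | |detForm e c a x| < δ * N} ≤ K * ENNReal.ofReal δ := by
  obtain ⟨K, hK, hK'⟩ := volume_detForm_lt_le_of_quadratic
  refine ⟨40 * K + 320, ENNReal.add_ne_top.2 ⟨ENNReal.mul_ne_top (by simp) hK, by simp⟩, ?_⟩
  intro e c a N δ hN hδ hsq
  -- The thresholds leave slope at least `N / 10 - N / 40 ≥ N / 20` when a linear coefficient is
  -- large, and make the constant term dominate on the cube when `a` and `c` are small.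
  by_cases hc : N / 40 ≤ |c|
  · have hc0 : 0 < |c| := by linarith
    calc _ ≤ K * ENNReal.ofReal (δ * N / |c|) := hK' e c a _ (abs_pos.1 hc0)
      _ ≤ K * ENNReal.ofReal (40 * δ) := by
          gcongr
          rw [div_le_iff₀ hc0]
          nlinarith
      _ = 40 * K * ENNReal.ofReal δ := by
          rw [ENNReal.ofReal_mul (by norm_num), ENNReal.ofReal_ofNat]
          ring
      _ ≤ _ := by gcongr; exact le_self_add
  push Not at hc
  by_cases ha : ∃ i, N / 10 ≤ |a i|
  · obtain ⟨i, hi⟩ := ha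
    calc _ ≤ 8 * ENNReal.ofReal (2 * (δ * N) / (N / 20)) :=
          volume_detForm_lt_le_of_slope (by positivity) i (by linarith)
      _ = 320 * ENNReal.ofReal δ := by
          rw [show 2 * (δ * N) / (N / 20) = 40 * δ by field_simp; ring,
            ENNReal.ofReal_mul (by norm_num), ENNReal.ofReal_ofNat, ← mul_assoc]
          norm_num
      _ ≤ _ := by gcongr; exact le_add_self
  push Not at ha
  -- Now the constant term dominates.
  have he : 9 / 10 * N ≤ |e| := by
    have h1 : ∀ z b : ℝ, |z| < b → z ^ 2 ≤ b ^ 2 := fun z b h =>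
      sq_le_sq' (abs_lt.1 h).1.le (abs_lt.1 h).2.le
    have hc2 := h1 _ _ hc
    have ha0 := h1 _ _ (ha 0)
    have ha1 := h1 _ _ (ha 1)
    have ha2 := h1 _ _ (ha 2)
    have ha3 := h1 _ _ (ha 3)
    refine abs_le_of_sq_le_sq' ?_ (abs_nonneg e) |>.2
    rw [sq_abs]
    nlinarith
  have hlow : ∀ x ∈ cube 4, N / 4 ≤ |detForm e c a x| := by
    intro x hx
    have hx' : ∀ i, |x i| ≤ 1 := fun i => abs_le.2 (hx i trivial)
    have hax : ∀ i, |a i * x i| ≤ N / 10 := fun i => by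
      rw [abs_mul]
      exact (mul_le_of_le_one_right (abs_nonneg _) (hx' i)).trans (ha i).le
    have hxx : ∀ i j, |x i * x j| ≤ 1 := fun i j => by
      rw [abs_mul]
      exact mul_le_one₀ (hx' i) (abs_nonneg _) (hx' j)
    have hcx : |c * (x 0 * x 3 - x 1 * x 2)| ≤ N / 20 := by
      rw [abs_mul]
      have h2 : |x 0 * x 3 - x 1 * x 2| ≤ 2 :=
        (abs_sub _ _).trans (by linarith [hxx 0 3, hxx 1 2])
      nlinarith [abs_nonneg c, abs_nonneg (x 0 * x 3 - x 1 * x 2)]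
    unfold detForm
    have h0 := abs_le.1 (hax 0)
    have h1 := abs_le.1 (hax 1)
    have h2 := abs_le.1 (hax 2)
    have h3 := abs_le.1 (hax 3)
    have h4 := abs_le.1 hcx
    rcases le_abs.1 he with h | h
    · exact le_abs.2 (Or.inl (by linarith))
    · exact le_abs.2 (Or.inr (by linarith))
  rcases le_or_gt δ (1 / 4) with hδ' | hδ'
  · refine (measure_mono_null (t := ∅) ?_ measure_empty).le.trans zero_le
    rintro x ⟨hx, hx'⟩
    have := hlow x hx
    exact absurd hx' (by nlinarith)
  · calc _ ≤ volume (cube 4) := measure_mono fun x hx => hx.1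
      _ = 64 * ENNReal.ofReal (1 / 4) := by
          rw [volume_cube, show (64 : ℝ≥0∞) = ENNReal.ofReal 64 by simp,
            ← ENNReal.ofReal_mul (by norm_num)]
          norm_num
      _ ≤ (40 * K + 320) * ENNReal.ofReal δ := by
          gcongr
          exact le_trans (by norm_num) le_add_self

end Planes

/-! ### Integer points on the Pluecker quadric -/

namespace Planes

/-- A set of integers of absolute value at most `X` that lies in one residue class modulo `m` has at
most `2 * X / m + 1` elements. -/
theorem card_le_of_dvd_sub {T : Finset ℤ} {X m : ℕ} (hm : 0 < m) (hT : ∀ t ∈ T, |t| ≤ X)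
    (hd : ∀ s ∈ T, ∀ t ∈ T, (m : ℤ) ∣ s - t) : T.card ≤ 2 * X / m + 1 := by
  rcases T.eq_empty_or_nonempty with rfl | hne
  · simp
  set t₀ := T.min' hne
  have hsub : T ⊆ (Finset.range (2 * X / m + 1)).image fun k : ℕ => t₀ + m * k := by
    intro t ht
    obtain ⟨k, hk⟩ := hd t ht t₀ (T.min'_mem hne)
    have h1 : t₀ ≤ t := T.min'_le t ht
    have h2 := abs_le.1 (hT t ht)
    have h3 := abs_le.1 (hT t₀ (T.min'_mem hne))
    have hk0 : 0 ≤ k := by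
      by_contra h
      have : (m : ℤ) * k < 0 := mul_neg_of_pos_of_neg (by exact_mod_cast hm) (not_le.1 h)
      omega
    lift k to ℕ using hk0
    refine Finset.mem_image.2 ⟨k, ?_, by omega⟩
    rw [Finset.mem_range, Nat.lt_succ_iff, Nat.le_div_iff_mul_le hm]
    zify
    nlinarith
  calc T.card ≤ _ := Finset.card_le_card hsub
    _ ≤ _ := Finset.card_image_le
    _ = _ := Finset.card_range _

theorem natAbs_div_gcd_dvd {a c x : ℤ} (ha : a ≠ 0) (h : a ∣ c * x) :
    ((a.natAbs / Int.gcd a c : ℕ) : ℤ) ∣ x := by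
  have hg : 0 < Int.gcd a c := Int.gcd_pos_of_ne_zero_left c ha
  rw [Int.natCast_dvd]
  have h' : a.natAbs ∣ c.natAbs * x.natAbs := by
    rw [← Int.natAbs_mul]
    exact Int.natAbs_dvd_natAbs.2 h
  have hcop : Nat.Coprime (a.natAbs / Int.gcd a c) (c.natAbs / Int.gcd a c) :=
    Nat.coprime_div_gcd_div_gcd hg
  refine hcop.dvd_of_dvd_mul_left (Nat.dvd_of_mul_dvd_mul_left hg ?_)
  rw [Nat.mul_div_cancel' (Int.gcd_dvd_natAbs_left a c), ← mul_assoc,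
    Nat.mul_div_cancel' (Int.gcd_dvd_natAbs_right a c)]
  exact h'

/-- The integer points `(d, f)` of a square for which `c * d + e * f` is divisible by `a`: those
`f` that occur lie in one residue class modulo `gcd(a, c) / gcd(a, c, e)`, and for each of them
the `d` lie in one residue class modulo `a / gcd(a, c)`. -/
theorem card_dvd_linear_form_le {a : ℤ} (ha : a ≠ 0) (c e : ℤ) {X : ℕ} (hX : 1 ≤ X) :
    ((((Finset.Icc (-X : ℤ) X) ×ˢ (Finset.Icc (-X : ℤ) X)).filter
      fun q : ℤ × ℤ => a ∣ c * q.1 + e * q.2).card : ℝ) ≤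
      4 * (X : ℝ) ^ 2 * (Int.gcd (Int.gcd a c) e / |(a : ℝ)|) + 5 * X := by
  set T := ((Finset.Icc (-X : ℤ) X) ×ˢ (Finset.Icc (-X : ℤ) X)).filter
      fun q : ℤ × ℤ => a ∣ c * q.1 + e * q.2 with hT
  set h := Int.gcd a c with hh
  set g := Int.gcd h e with hg
  have hpos : 0 < h := Int.gcd_pos_of_ne_zero_left c ha
  have gpos : 0 < g := Int.gcd_pos_of_ne_zero_left e (by exact_mod_cast hpos.ne')
  obtain ⟨m₁, hm₁⟩ : h ∣ a.natAbs := Int.gcd_dvd_natAbs_left a c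
  obtain ⟨m₂, hm₂⟩ : g ∣ h := by simpa using Int.gcd_dvd_natAbs_left (h : ℤ) e
  have apos : 0 < a.natAbs := Int.natAbs_pos.2 ha
  have m₁pos : 0 < m₁ := Nat.pos_of_ne_zero fun h0 => by simp [h0] at hm₁; exact ha hm₁
  have m₂pos : 0 < m₂ := Nat.pos_of_ne_zero fun h0 => by simp [h0] at hm₂; omega
  have e₁ : a.natAbs / h = m₁ := by rw [hm₁, Nat.mul_div_cancel_left _ hpos]
  have e₂ : h / g = m₂ := by rw [hm₂, Nat.mul_div_cancel_left _ gpos]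
  have hmem : ∀ q ∈ T, |q.1| ≤ X ∧ |q.2| ≤ X ∧ a ∣ c * q.1 + e * q.2 := by
    intro q hq
    simp only [hT, Finset.mem_filter, Finset.mem_product, Finset.mem_Icc] at hq
    exact ⟨abs_le.2 hq.1.1, abs_le.2 hq.1.2, hq.2⟩
  have hfib : ∀ f ∈ T.image Prod.snd, (T.filter fun q => q.2 = f).card ≤ 2 * X / m₁ + 1 := by
    intro f _
    rw [← Finset.card_image_of_injOn (f := Prod.fst)]
    · refine card_le_of_dvd_sub m₁pos ?_ ?_
      · intro t ht
        obtain ⟨q, hq, rfl⟩ := Finset.mem_image.1 ht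
        exact (hmem q (Finset.mem_filter.1 hq).1).1
      · intro s hs t ht
        obtain ⟨q, hq, rfl⟩ := Finset.mem_image.1 hs
        obtain ⟨q', hq', rfl⟩ := Finset.mem_image.1 ht
        rw [Finset.mem_filter] at hq hq'
        rw [← e₁]
        refine natAbs_div_gcd_dvd (c := c) ha ?_
        have := dvd_sub (hmem q hq.1).2.2 (hmem q' hq'.1).2.2
        rw [hq.2, hq'.2] at this
        rwa [show c * q.1 + e * f - (c * q'.1 + e * f) = c * (q.1 - q'.1) by ring] at this
    · intro q hq q' hq' heq
      have h1 := (Finset.mem_filter.1 hq).2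
      have h2 := (Finset.mem_filter.1 hq').2
      exact Prod.ext heq (h1.trans h2.symm)
  have himg : (T.image Prod.snd).card ≤ 2 * X / m₂ + 1 := by
    have hdvd : ∀ q ∈ T, (h : ℤ) ∣ e * q.2 := by
      intro q hq
      have h1 : (h : ℤ) ∣ c * q.1 + e * q.2 := (Int.gcd_dvd_left a c).trans (hmem q hq).2.2
      exact (dvd_add_right ((Int.gcd_dvd_right a c).mul_right q.1)).1 h1
    refine card_le_of_dvd_sub m₂pos ?_ ?_
    · intro t ht
      obtain ⟨q, hq, rfl⟩ := Finset.mem_image.1 ht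
      exact (hmem q hq).2.1
    · intro s hs t ht
      obtain ⟨q, hq, rfl⟩ := Finset.mem_image.1 hs
      obtain ⟨q', hq', rfl⟩ := Finset.mem_image.1 ht
      have := natAbs_div_gcd_dvd (a := h) (c := e) (x := q.2 - q'.2) (by exact_mod_cast hpos.ne')
        (by rw [mul_sub]; exact dvd_sub (hdvd q hq) (hdvd q' hq'))
      rwa [Int.natAbs_natCast, ← hg, e₂] at this
  have hcard : (T.card : ℝ) ≤ (2 * X / m₁ + 1) * (2 * X / m₂ + 1) := by
    have h1 : T.card ≤ (2 * X / m₁ + 1) * (2 * X / m₂ + 1) :=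
      (Finset.card_le_mul_card_image T _ hfib).trans (Nat.mul_le_mul_left _ himg)
    calc (T.card : ℝ) ≤ (((2 * X / m₁ + 1) * (2 * X / m₂ + 1) : ℕ) : ℝ) := by exact_mod_cast h1
      _ = (((2 * X / m₁ : ℕ) : ℝ) + 1) * (((2 * X / m₂ : ℕ) : ℝ) + 1) := by push_cast; rfl
      _ ≤ _ := by
        have := @Nat.cast_div_le ℝ _ _ _ (2 * X) m₁
        have := @Nat.cast_div_le ℝ _ _ _ (2 * X) m₂
        push_cast at *
        gcongr
  have habs : |(a : ℝ)| = g * m₂ * m₁ := by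
    rw [← Int.cast_abs, Int.abs_eq_natAbs, hm₁, hm₂]
    push_cast
    rfl
  have hg' : (g : ℝ) / |(a : ℝ)| = 1 / (m₁ * m₂) := by
    rw [habs]
    have : (0 : ℝ) < g := by exact_mod_cast gpos
    have : (0 : ℝ) < m₁ := by exact_mod_cast m₁pos
    have : (0 : ℝ) < m₂ := by exact_mod_cast m₂pos
    field_simp
  have hX' : (1 : ℝ) ≤ X := by exact_mod_cast hX
  have h1 : (2 * X / m₁ : ℝ) ≤ 2 * X := div_le_self (by positivity) (by exact_mod_cast m₁pos)
  have h2 : (2 * X / m₂ : ℝ) ≤ 2 * X := div_le_self (by positivity) (by exact_mod_cast m₂pos)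
  have h3 : (2 * X / m₁ : ℝ) * (2 * X / m₂) = 4 * X ^ 2 * (1 / (m₁ * m₂)) := by
    field_simp
    ring
  rw [hg']
  nlinarith

/-- The sum of `gcd(n, c, e)` over the square `|c|, |e| ≤ n`. -/
theorem sum_gcd_le (a : ℤ) (ha : a ≠ 0) :
    ∑ q ∈ (Finset.Icc (-|a|) |a|) ×ˢ (Finset.Icc (-|a|) |a|),
      (Int.gcd (Int.gcd a q.1) q.2 : ℝ) ≤
      9 * |(a : ℝ)| ^ 2 * ∑ d ∈ a.natAbs.divisors, (1 / d : ℝ) := by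
  set n := a.natAbs with hn
  have hn0 : n ≠ 0 := Int.natAbs_ne_zero.2 ha
  have haz : |a| = n := Int.abs_eq_natAbs a
  have har : |(a : ℝ)| = n := by
    rw [← Int.cast_abs, haz]
    rfl
  rw [haz, har]
  set I := Finset.Icc (-n : ℤ) n with hI
  -- A positive integer is at most the sum of its divisors.
  have h1 : ∀ q ∈ I ×ˢ I, (Int.gcd (Int.gcd a q.1) q.2 : ℝ) ≤
      ∑ d ∈ n.divisors, if (d : ℤ) ∣ q.1 ∧ (d : ℤ) ∣ q.2 then (d : ℝ) else 0 := by
    intro q _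
    set g := Int.gcd (Int.gcd a q.1) q.2 with hg
    have hg1 : (g : ℤ) ∣ Int.gcd a q.1 := Int.gcd_dvd_left _ _
    have hgn : g ∣ n := by
      have : (g : ℤ) ∣ a := hg1.trans (Int.gcd_dvd_left _ _)
      exact Int.natCast_dvd.1 this
    have hgq : (g : ℤ) ∣ q.1 ∧ (g : ℤ) ∣ q.2 :=
      ⟨hg1.trans (Int.gcd_dvd_right _ _), Int.gcd_dvd_right _ _⟩
    refine le_trans (le_of_eq ?_) (Finset.single_le_sum (f := fun d : ℕ =>
      if (d : ℤ) ∣ q.1 ∧ (d : ℤ) ∣ q.2 then (d : ℝ) else 0) ?_ (Nat.mem_divisors.2 ⟨hgn, hn0⟩))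
    · rw [if_pos hgq]
    · intro d _
      split_ifs <;> positivity
  refine (Finset.sum_le_sum h1).trans ?_
  rw [Finset.sum_comm, Finset.mul_sum]
  refine Finset.sum_le_sum fun d hd => ?_
  have hdn := Nat.dvd_of_mem_divisors hd
  have hd0 : 0 < d := Nat.pos_of_mem_divisors hd
  have hdle : d ≤ n := Nat.divisor_le hd
  have hfilter : ((I ×ˢ I).filter fun q : ℤ × ℤ => (d : ℤ) ∣ q.1 ∧ (d : ℤ) ∣ q.2) =
      (I.filter fun z => (d : ℤ) ∣ z) ×ˢ (I.filter fun z => (d : ℤ) ∣ z) := by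
    ext q
    simp only [Finset.mem_filter, Finset.mem_product]
    tauto
  have hcard : ((I.filter fun z => (d : ℤ) ∣ z).card : ℝ) ≤ 3 * (n / d) := by
    have h2 : (I.filter fun z => (d : ℤ) ∣ z).card ≤ 2 * n / d + 1 := by
      refine card_le_of_dvd_sub hd0 ?_ ?_
      · intro t ht
        exact abs_le.2 (Finset.mem_Icc.1 (Finset.mem_filter.1 ht).1)
      · intro s hs t ht
        exact dvd_sub (Finset.mem_filter.1 hs).2 (Finset.mem_filter.1 ht).2
    have h3 : ((2 * n / d : ℕ) : ℝ) ≤ 2 * n / d := by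
      have := @Nat.cast_div_le ℝ _ _ _ (2 * n) d
      push_cast at this
      exact this
    have h4 : (1 : ℝ) ≤ n / d := by
      rw [one_le_div (by exact_mod_cast hd0)]
      exact_mod_cast hdle
    calc ((I.filter fun z => (d : ℤ) ∣ z).card : ℝ) ≤ ((2 * n / d : ℕ) : ℝ) + 1 := by
          exact_mod_cast h2
      _ ≤ 2 * n / d + n / d := add_le_add h3 h4
      _ = 3 * (n / d) := by ring
  rw [← Finset.sum_filter, hfilter, Finset.sum_const, Finset.card_product, nsmul_eq_mul]
  push_cast
  have hd0' : (0 : ℝ) < d := by exact_mod_cast hd0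
  calc _ ≤ (3 * (n / d : ℝ)) * (3 * (n / d)) * d := by gcongr
    _ = 9 * (n : ℝ) ^ 2 * (1 / d) := by
      field_simp
      ring

/-- The sum equals `∑ d ≤ X, ⌊X / d⌋ / d`, hence is dominated by `X * ∑ d⁻²`. -/
theorem sum_sum_divisors_inv_le (X : ℕ) :
    ∑ n ∈ Finset.Icc 1 X, ∑ d ∈ n.divisors, (1 / d : ℝ) ≤ 2 * X := by
  have h1 : ∀ n ∈ Finset.Icc 1 X, ∑ d ∈ n.divisors, (1 / d : ℝ) =
      ∑ d ∈ Finset.Icc 1 X, if d ∣ n then (1 / d : ℝ) else 0 := by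
    intro n hn
    rw [← Finset.sum_filter]
    refine Finset.sum_congr ?_ fun _ _ => rfl
    rw [Finset.mem_Icc] at hn
    ext d
    simp only [Nat.mem_divisors, Finset.mem_filter, Finset.mem_Icc]
    constructor
    · rintro ⟨hd, _⟩
      exact ⟨⟨Nat.pos_of_dvd_of_pos hd hn.1, (Nat.le_of_dvd hn.1 hd).trans hn.2⟩, hd⟩
    · rintro ⟨-, hd⟩
      exact ⟨hd, by omega⟩
  rw [Finset.sum_congr rfl h1, Finset.sum_comm]
  have h2 : ∀ d ∈ Finset.Icc 1 X, (∑ n ∈ Finset.Icc 1 X, if d ∣ n then (1 / d : ℝ) else 0) ≤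
      X * ((d : ℝ) ^ 2)⁻¹ := by
    intro d hd
    have hd0 : (0 : ℝ) < d := by exact_mod_cast (Finset.mem_Icc.1 hd).1
    rw [← Finset.sum_filter, Finset.sum_const, nsmul_eq_mul]
    have : (Finset.Icc 1 X).filter (fun n => d ∣ n) = (Finset.Ioc 0 X).filter fun n => d ∣ n := rfl
    rw [this, Nat.Ioc_filter_dvd_card_eq_div]
    calc ((X / d : ℕ) : ℝ) * (1 / d) ≤ (X / d : ℝ) * (1 / d) := by
          gcongr
          exact Nat.cast_div_le
      _ = X * ((d : ℝ) ^ 2)⁻¹ := by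
          field_simp
  refine (Finset.sum_le_sum h2).trans ?_
  rw [← Finset.mul_sum, mul_comm]
  gcongr
  have h3 := sum_Ioo_inv_sq_le (α := ℝ) 0 (X + 1)
  have h4 : Finset.Ioo 0 (X + 1) = Finset.Icc 1 X := by
    ext
    simp only [Finset.mem_Ioo, Finset.mem_Icc]
    omega
  rw [h4] at h3
  simpa using h3

/-- The integer points `(u, v)` of height at most `X` on the quadric `u ⬝ v = 0`. -/
noncomputable def orthogonalPairs (X : ℕ) : Finset ((Fin 3 → ℤ) × (Fin 3 → ℤ)) :=
  ((Fintype.piFinset fun _ => Finset.Icc (-X : ℤ) X) ×ˢ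
    (Fintype.piFinset fun _ => Finset.Icc (-X : ℤ) X)).filter
      fun w => ∑ i, w.1 i * w.2 i = 0

theorem mem_orthogonalPairs {X : ℕ} {w : (Fin 3 → ℤ) × (Fin 3 → ℤ)} :
    w ∈ orthogonalPairs X ↔ (∀ i, |w.1 i| ≤ X) ∧ (∀ i, |w.2 i| ≤ X) ∧
      ∑ i, w.1 i * w.2 i = 0 := by
  simp [orthogonalPairs, abs_le, and_assoc]

/-- The pairs for which the coordinate `i` of `u` is nonzero and of maximal absolute value. -/
noncomputable def dominatedPairs (X : ℕ) (i : Fin 3) : Finset ((Fin 3 → ℤ) × (Fin 3 → ℤ)) :=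
  (orthogonalPairs X).filter fun w => w.1 i ≠ 0 ∧ ∀ j, |w.1 j| ≤ |w.1 i|

/-- Interchanging the coordinates `0` and `i` maps one set of dominated pairs into the other. -/
theorem card_dominatedPairs_le (X : ℕ) (i : Fin 3) :
    (dominatedPairs X i).card ≤ (dominatedPairs X 0).card := by
  set τ := Equiv.swap (0 : Fin 3) i with hτ
  refine Finset.card_le_card_of_injOn (fun w => (w.1 ∘ τ, w.2 ∘ τ)) ?_ ?_
  · intro w hw
    simp only [dominatedPairs, Finset.coe_filter, Set.mem_ofPred_eq, mem_orthogonalPairs] at hw ⊢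
    obtain ⟨⟨h1, h2, h3⟩, h4, h5⟩ := hw
    have h0 : τ 0 = i := Equiv.swap_apply_left 0 i
    refine ⟨⟨fun j => h1 _, fun j => h2 _, ?_⟩, ?_, fun j => ?_⟩
    · rw [← h3]
      exact Equiv.sum_comp τ fun j => w.1 j * w.2 j
    · simpa [h0] using h4
    · simpa [h0] using h5 (τ j)
  · rintro ⟨u, v⟩ _ ⟨u', v'⟩ _ h
    simp only [Prod.mk.injEq] at h
    rw [Prod.mk.injEq]
    exact ⟨τ.surjective.injective_comp_right h.1, τ.surjective.injective_comp_right h.2⟩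

theorem card_dominatedPairs_zero_le {X : ℕ} (hX : 1 ≤ X) :
    ((dominatedPairs X 0).card : ℝ) ≤ 300 * (X : ℝ) ^ 4 := by
  set A := (Finset.Icc (-X : ℤ) X).erase 0 with hA
  set J : ℤ → Finset (ℤ × ℤ) := fun a => (Finset.Icc (-|a|) |a|) ×ˢ (Finset.Icc (-|a|) |a|) with hJ
  set T : ℤ → ℤ × ℤ → Finset (ℤ × ℤ) := fun a q =>
    ((Finset.Icc (-X : ℤ) X) ×ˢ (Finset.Icc (-X : ℤ) X)).filter
      fun r : ℤ × ℤ => a ∣ q.1 * r.1 + q.2 * r.2 with hT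
  have hX' : (1 : ℝ) ≤ X := by exact_mod_cast hX
  -- The coordinate `v 0` is determined by the others.
  have hcard : (dominatedPairs X 0).card ≤ (A.sigma fun a => (J a).sigma fun q => T a q).card := by
    refine Finset.card_le_card_of_injOn
      (fun w => ⟨w.1 0, ⟨(w.1 1, w.1 2), (w.2 1, w.2 2)⟩⟩) ?_ ?_
    · intro w hw
      simp only [dominatedPairs, Finset.coe_filter, Set.mem_ofPred_eq, mem_orthogonalPairs,
        Fin.sum_univ_three] at hw
      obtain ⟨⟨h1, h2, h3⟩, h4, h5⟩ := hw
      simp only [Finset.mem_coe, Finset.mem_sigma, hA, hJ, hT, Finset.mem_erase, Finset.mem_Icc,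
        Finset.mem_product, Finset.mem_filter]
      refine ⟨⟨h4, abs_le.1 (h1 0)⟩, ⟨abs_le.1 (h5 1), abs_le.1 (h5 2)⟩,
        ⟨abs_le.1 (h2 1), abs_le.1 (h2 2)⟩, ⟨-w.2 0, ?_⟩⟩
      linear_combination h3
    · rintro ⟨u, v⟩ hw ⟨u', v'⟩ hw' h
      simp only [dominatedPairs, Finset.coe_filter, Set.mem_ofPred_eq, mem_orthogonalPairs,
        Fin.sum_univ_three] at hw hw'
      simp only [Sigma.mk.injEq, heq_eq_eq, Prod.mk.injEq] at h
      obtain ⟨h0, hh⟩ := h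
      obtain ⟨⟨h1, h2⟩, h3, h4⟩ := by simpa using hh
      have h5 : v 0 = v' 0 := by
        refine mul_left_cancel₀ hw.2.1 ?_
        have e1 := hw.1.2.2
        have e2 := hw'.1.2.2
        rw [← h0, ← h1, ← h2, ← h3, ← h4] at e2
        linear_combination e1 - e2
      rw [Prod.mk.injEq]
      constructor <;> ext j <;> fin_cases j <;> assumption
  have hterm : ∀ a ∈ A, ∑ q ∈ J a, ((T a q).card : ℝ) ≤
      36 * (X : ℝ) ^ 3 * ∑ d ∈ a.natAbs.divisors, (1 / d : ℝ) + 45 * (X : ℝ) ^ 3 := by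
    intro a ha
    rw [hA, Finset.mem_erase, Finset.mem_Icc] at ha
    have ha0 : (0 : ℝ) < |(a : ℝ)| := abs_pos.2 (by exact_mod_cast ha.1)
    have haX : |(a : ℝ)| ≤ X := by
      rw [← Int.cast_abs]
      exact_mod_cast abs_le.2 ha.2
    have hJcard : ((J a).card : ℝ) ≤ 9 * (X : ℝ) ^ 2 := by
      rw [hJ]
      simp only [Finset.card_product, Int.card_Icc]
      have h1 : ((|a| + 1 - -|a|).toNat : ℤ) ≤ 3 * X := by
        have := abs_le.2 ha.2
        omega
      have h2 : ((|a| + 1 - -|a|).toNat : ℝ) ≤ 3 * X := by exact_mod_cast h1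
      push_cast
      calc _ ≤ (3 * X : ℝ) * (3 * X) := by gcongr
        _ = _ := by ring
    calc ∑ q ∈ J a, ((T a q).card : ℝ)
        ≤ ∑ q ∈ J a, (4 * (X : ℝ) ^ 2 / |(a : ℝ)| * (Int.gcd (Int.gcd a q.1) q.2 : ℝ) + 5 * X) :=
          Finset.sum_le_sum fun q _ =>
            (card_dvd_linear_form_le ha.1 q.1 q.2 hX).trans (le_of_eq (by ring))
      _ = 4 * (X : ℝ) ^ 2 / |(a : ℝ)| * ∑ q ∈ J a, (Int.gcd (Int.gcd a q.1) q.2 : ℝ) +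
          (J a).card * (5 * X) := by
          rw [Finset.sum_add_distrib, Finset.mul_sum, Finset.sum_const, nsmul_eq_mul]
      _ ≤ 4 * (X : ℝ) ^ 2 / |(a : ℝ)| *
            (9 * |(a : ℝ)| ^ 2 * ∑ d ∈ a.natAbs.divisors, (1 / d : ℝ)) +
          9 * (X : ℝ) ^ 2 * (5 * X) := by
          gcongr
          exact sum_gcd_le a ha.1
      _ = 36 * (X : ℝ) ^ 2 * |(a : ℝ)| * ∑ d ∈ a.natAbs.divisors, (1 / d : ℝ) +
          45 * (X : ℝ) ^ 3 := by
          field_simp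
          ring
      _ ≤ 36 * (X : ℝ) ^ 2 * X * ∑ d ∈ a.natAbs.divisors, (1 / d : ℝ) + 45 * (X : ℝ) ^ 3 := by
          gcongr
      _ = _ := by ring
  have hAcard : (A.card : ℝ) = 2 * X := by
    have h0 : A.card = 2 * X := by
      rw [hA, Finset.card_erase_of_mem (by simp), Int.card_Icc]
      omega
    rw [h0]
    push_cast
    rfl
  -- Each positive integer is the absolute value of two elements of `A`.
  have hAsum : ∑ a ∈ A, ∑ d ∈ a.natAbs.divisors, (1 / d : ℝ) ≤ 4 * X := by
    have hmaps : ∀ a ∈ A, a.natAbs ∈ Finset.Icc 1 X := by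
      intro a ha
      rw [hA, Finset.mem_erase, Finset.mem_Icc] at ha
      rw [Finset.mem_Icc]
      omega
    rw [← Finset.sum_fiberwise_of_maps_to hmaps]
    calc _ ≤ ∑ n ∈ Finset.Icc 1 X, 2 * ∑ d ∈ n.divisors, (1 / d : ℝ) := by
          refine Finset.sum_le_sum fun n _ => ?_
          have hc : (A.filter fun a => a.natAbs = n).card ≤ 2 := by
            refine (Finset.card_le_card (t := {(n : ℤ), -(n : ℤ)}) ?_).trans Finset.card_le_two
            intro a ha
            rw [Finset.mem_filter] at ha
            simp only [Finset.mem_insert, Finset.mem_singleton]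
            omega
          rw [Finset.sum_congr rfl (g := fun _ => ∑ d ∈ n.divisors, (1 / d : ℝ)),
            Finset.sum_const, nsmul_eq_mul]
          · gcongr
            exact_mod_cast hc
          · intro a ha
            rw [(Finset.mem_filter.1 ha).2]
      _ ≤ 4 * X := by
          rw [← Finset.mul_sum]
          linarith [sum_sum_divisors_inv_le X]
  calc ((dominatedPairs X 0).card : ℝ)
      ≤ ((A.sigma fun a => (J a).sigma fun q => T a q).card : ℝ) := by exact_mod_cast hcard
    _ = ∑ a ∈ A, ∑ q ∈ J a, ((T a q).card : ℝ) := by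
        simp only [Finset.card_sigma]
        push_cast
        rfl
    _ ≤ ∑ a ∈ A, (36 * (X : ℝ) ^ 3 * ∑ d ∈ a.natAbs.divisors, (1 / d : ℝ) + 45 * (X : ℝ) ^ 3) :=
        Finset.sum_le_sum hterm
    _ = 36 * (X : ℝ) ^ 3 * ∑ a ∈ A, ∑ d ∈ a.natAbs.divisors, (1 / d : ℝ) +
        2 * X * (45 * (X : ℝ) ^ 3) := by
        rw [Finset.sum_add_distrib, Finset.mul_sum, Finset.sum_const, nsmul_eq_mul, hAcard]
    _ ≤ 36 * (X : ℝ) ^ 3 * (4 * X) + 2 * X * (45 * (X : ℝ) ^ 3) := by gcongr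
    _ ≤ 300 * (X : ℝ) ^ 4 := by nlinarith [pow_pos (zero_lt_one.trans_le hX') 4]

/-- The quadric `u ⬝ v = 0` in `ℝ^6` has `O(X^4)` integer points of height at most `X`, without a
logarithmic factor. -/
theorem card_orthogonalPairs_le {X : ℕ} (hX : 1 ≤ X) :
    ((orthogonalPairs X).card : ℝ) ≤ 927 * (X : ℝ) ^ 4 := by
  set Z := ({0} : Finset (Fin 3 → ℤ)) ×ˢ
    (Fintype.piFinset fun _ : Fin 3 => Finset.Icc (-X : ℤ) X) with hZ
  have hX' : (1 : ℝ) ≤ X := by exact_mod_cast hX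
  have hsub : orthogonalPairs X ⊆ Z ∪ Finset.univ.biUnion (dominatedPairs X) := by
    intro w hw
    have hw' := mem_orthogonalPairs.1 hw
    rw [Finset.mem_union]
    by_cases h0 : w.1 = 0
    · left
      simp only [hZ, Finset.mem_product, Finset.mem_singleton, Fintype.mem_piFinset,
        Finset.mem_Icc]
      exact ⟨h0, fun i => abs_le.1 (hw'.2.1 i)⟩
    · right
      obtain ⟨i, hi⟩ := Finite.exists_max fun j => |w.1 j|
      refine Finset.mem_biUnion.2
        ⟨i, Finset.mem_univ i, Finset.mem_filter.2 ⟨hw, fun h => h0 ?_, hi⟩⟩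
      ext j
      have := hi j
      rw [h, abs_zero] at this
      exact abs_nonpos_iff.1 this
  have hZcard : (Z.card : ℝ) ≤ 27 * (X : ℝ) ^ 4 := by
    have h1 : Z.card = (2 * X + 1) ^ 3 := by
      rw [hZ, Finset.card_product, Finset.card_singleton, one_mul, Fintype.card_piFinset]
      simp only [Int.card_Icc, Finset.prod_const, Finset.card_univ, Fintype.card_fin]
      congr 1
      omega
    rw [h1]
    push_cast
    calc (2 * X + 1 : ℝ) ^ 3 ≤ (3 * X) ^ 3 := by gcongr; linarith
      _ = 27 * ((X : ℝ) ^ 3 * 1) := by ring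
      _ ≤ 27 * ((X : ℝ) ^ 3 * X) := by gcongr
      _ = _ := by ring
  have hle : (orthogonalPairs X).card ≤ Z.card + 3 * (dominatedPairs X 0).card := by
    refine (Finset.card_le_card hsub).trans ((Finset.card_union_le _ _).trans ?_)
    gcongr
    exact Finset.card_biUnion_le_card_mul _ _ _ fun i _ => card_dominatedPairs_le X i
  have hle' : ((orthogonalPairs X).card : ℝ) ≤ Z.card + 3 * (dominatedPairs X 0).card := by
    exact_mod_cast hle
  linarith [card_dominatedPairs_zero_le hX]

end Planes

/-! ### Pluecker vectors, heights and angles -/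

namespace Planes

/-- The bilinear form on `Λ²ℝ⁴` given by the wedge product `Λ²ℝ⁴ × Λ²ℝ⁴ → Λ⁴ℝ⁴ = ℝ`. Two planes
meet nontrivially if and only if their Pluecker vectors are orthogonal for it. -/
def klein (p P : Fin 4 → Fin 4 → ℝ) : ℝ :=
  p 0 1 * P 2 3 - p 0 2 * P 1 3 + p 0 3 * P 1 2 + p 1 2 * P 0 3 - p 1 3 * P 0 2 + p 2 3 * P 0 1

/-- The antisymmetric array with `(p₀₁, p₀₂, p₀₃) = u` and `(p₂₃, -p₁₃, p₁₂) = v`, for a pair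
`(u, v)` of integer vectors. The Pluecker relation reads `u ⬝ v = 0`. -/
def pairArray (w : (Fin 3 → ℤ) × (Fin 3 → ℤ)) : Fin 4 → Fin 4 → ℝ :=
  ![![0, w.1 0, w.1 1, w.1 2], ![-w.1 0, 0, w.2 2, -w.2 1], ![-w.1 1, -w.2 2, 0, w.2 0],
    ![-w.1 2, w.2 1, -w.2 0, 0]]

/-- The Euclidean norm of the pair `(u, v)` as a vector in `ℝ^6`. -/
noncomputable def pairNorm (w : (Fin 3 → ℤ) × (Fin 3 → ℤ)) : ℝ :=
  Real.sqrt (((∑ i, w.1 i ^ 2 + ∑ i, w.2 i ^ 2 : ℤ) : ℝ))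

theorem pairNorm_sq (w : (Fin 3 → ℤ) × (Fin 3 → ℤ)) :
    pairNorm w ^ 2 = ∑ i, (w.1 i : ℝ) ^ 2 + ∑ i, (w.2 i : ℝ) ^ 2 := by
  rw [pairNorm, Real.sq_sqrt]
  · push_cast
    rfl
  · exact_mod_cast (by positivity : (0 : ℤ) ≤ ∑ i, w.1 i ^ 2 + ∑ i, w.2 i ^ 2)

theorem one_le_pairNorm {w : (Fin 3 → ℤ) × (Fin 3 → ℤ)} (hw : w ≠ 0) : 1 ≤ pairNorm w := by
  rw [pairNorm, Real.one_le_sqrt]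
  suffices h : (0 : ℤ) < ∑ i, w.1 i ^ 2 + ∑ i, w.2 i ^ 2 by exact_mod_cast h
  by_contra! h
  refine hw (Prod.ext ?_ ?_) <;> ext i
  · have h1 := Finset.single_le_sum (f := fun i => w.1 i ^ 2) (fun i _ => sq_nonneg _)
      (Finset.mem_univ i)
    have h2 : (0 : ℤ) ≤ ∑ i, w.2 i ^ 2 := by positivity
    exact pow_eq_zero_iff two_ne_zero |>.1 (le_antisymm (by linarith) (sq_nonneg (w.1 i)))
  · have h1 := Finset.single_le_sum (f := fun i => w.2 i ^ 2) (fun i _ => sq_nonneg _)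
      (Finset.mem_univ i)
    have h2 : (0 : ℤ) ≤ ∑ i, w.1 i ^ 2 := by positivity
    exact pow_eq_zero_iff two_ne_zero |>.1 (le_antisymm (by linarith) (sq_nonneg (w.2 i)))

theorem abs_le_pairNorm (w : (Fin 3 → ℤ) × (Fin 3 → ℤ)) (i : Fin 3) :
    |(w.1 i : ℝ)| ≤ pairNorm w ∧ |(w.2 i : ℝ)| ≤ pairNorm w := by
  have h1 := Finset.single_le_sum (f := fun i => (w.1 i : ℝ) ^ 2) (fun i _ => sq_nonneg _)
    (Finset.mem_univ i)
  have h2 := Finset.single_le_sum (f := fun i => (w.2 i : ℝ) ^ 2) (fun i _ => sq_nonneg _)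
    (Finset.mem_univ i)
  have h3 : 0 ≤ ∑ i, (w.1 i : ℝ) ^ 2 := by positivity
  have h4 : 0 ≤ ∑ i, (w.2 i : ℝ) ^ 2 := by positivity
  constructor <;> refine abs_le_of_sq_le_sq ?_ (Real.sqrt_nonneg _) <;> rw [pairNorm_sq] <;>
    linarith

theorem abs_pairArray_le (w : (Fin 3 → ℤ) × (Fin 3 → ℤ)) (k l : Fin 4) :
    |pairArray w k l| ≤ pairNorm w := by
  have h := abs_le_pairNorm w
  have h0 : 0 ≤ pairNorm w := Real.sqrt_nonneg _
  fin_cases k <;> fin_cases l <;> simp [pairArray, h, h0]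

theorem mem_orthogonalPairs_of_pairNorm_lt {w : (Fin 3 → ℤ) × (Fin 3 → ℤ)} {X : ℕ}
    (h : pairNorm w < X) (h0 : ∑ i, w.1 i * w.2 i = 0) : w ∈ orthogonalPairs X := by
  rw [mem_orthogonalPairs]
  refine ⟨fun i => ?_, fun i => ?_, h0⟩
  · have := (abs_le_pairNorm w i).1.trans h.le
    exact_mod_cast this
  · have := (abs_le_pairNorm w i).2.trans h.le
    exact_mod_cast this

/-- The restriction of `klein · (pairArray w)` to the chart `ν_{i,j}`, in terms of the chart
coordinates and up to the sign of `σ`. The quadratic term stems from the coordinate `p_{i',j'}`,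
which the Pluecker relation expresses through the others. -/
def chartForm (σ : Equiv.Perm (Fin 4)) (w : (Fin 3 → ℤ) × (Fin 3 → ℤ)) : (Fin 4 → ℝ) → ℝ :=
  detForm (pairArray w (σ 2) (σ 3)) (pairArray w (σ 0) (σ 1))
    ![-pairArray w (σ 0) (σ 3), -pairArray w (σ 1) (σ 3), pairArray w (σ 0) (σ 2),
      pairArray w (σ 1) (σ 2)]

set_option maxRecDepth 20000 in
theorem perm_cases {σ : Equiv.Perm (Fin 4)} (h01 : σ 0 < σ 1) (h23 : σ 2 < σ 3) :
    (σ 0 = 0 ∧ σ 1 = 1 ∧ σ 2 = 2 ∧ σ 3 = 3) ∨ (σ 0 = 0 ∧ σ 1 = 2 ∧ σ 2 = 1 ∧ σ 3 = 3) ∨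
    (σ 0 = 0 ∧ σ 1 = 3 ∧ σ 2 = 1 ∧ σ 3 = 2) ∨ (σ 0 = 1 ∧ σ 1 = 2 ∧ σ 2 = 0 ∧ σ 3 = 3) ∨
    (σ 0 = 1 ∧ σ 1 = 3 ∧ σ 2 = 0 ∧ σ 3 = 2) ∨ (σ 0 = 2 ∧ σ 1 = 3 ∧ σ 2 = 0 ∧ σ 3 = 1) := by
  have key : ∀ q : Fin 4 × Fin 4 × Fin 4 × Fin 4,
      (q.1 < q.2.1 ∧ q.2.2.1 < q.2.2.2 ∧ q.1 ≠ q.2.2.1 ∧ q.1 ≠ q.2.2.2 ∧ q.2.1 ≠ q.2.2.1 ∧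
        q.2.1 ≠ q.2.2.2) → q ∈ [(0, 1, 2, 3), (0, 2, 1, 3), (0, 3, 1, 2), (1, 2, 0, 3),
          (1, 3, 0, 2), (2, 3, 0, 1)] := by decide
  simpa using key (σ 0, σ 1, σ 2, σ 3) ⟨h01, h23, σ.injective.ne (by decide),
    σ.injective.ne (by decide), σ.injective.ne (by decide), σ.injective.ne (by decide)⟩

theorem abs_klein_eq_abs_chartForm {σ : Equiv.Perm (Fin 4)} (h01 : σ 0 < σ 1) (h23 : σ 2 < σ 3)
    {p : Fin 4 → Fin 4 → ℝ} (hp : p ∈ W (σ 0) (σ 1)) (w : (Fin 3 → ℤ) × (Fin 3 → ℤ)) :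
    |klein p (pairArray w)| = |chartForm σ w (nu σ p)| := by
  obtain ⟨ha, h1, -, hq⟩ := hp
  have a10 := ha 0 1
  have a20 := ha 0 2
  have a30 := ha 0 3
  have a21 := ha 1 2
  have a31 := ha 1 3
  have a32 := ha 2 3
  rcases perm_cases h01 h23 with ⟨e0, e1, e2, e3⟩ | ⟨e0, e1, e2, e3⟩ | ⟨e0, e1, e2, e3⟩ |
      ⟨e0, e1, e2, e3⟩ | ⟨e0, e1, e2, e3⟩ | ⟨e0, e1, e2, e3⟩ <;>
    rw [e0, e1] at h1 <;>
    simp only [chartForm, klein, detForm, nu, e0, e1, e2, e3, pairArray, Matrix.cons_val,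
      a10, a20, a30, a21, a31, a32, h1] at hq ⊢
  · congr 1
    linear_combination (w.1 0 : ℝ) * hq
  · rw [← abs_neg]
    congr 1
    linear_combination -(w.1 1 : ℝ) * hq
  · congr 1
    linear_combination (w.1 2 : ℝ) * hq
  · congr 1
    linear_combination (w.2 2 : ℝ) * hq
  · rw [← abs_neg]
    congr 1
    linear_combination (w.2 1 : ℝ) * hq
  · congr 1
    linear_combination (w.2 0 : ℝ) * hq

theorem pairNorm_sq_eq_chartForm {σ : Equiv.Perm (Fin 4)} (h01 : σ 0 < σ 1) (h23 : σ 2 < σ 3)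
    (w : (Fin 3 → ℤ) × (Fin 3 → ℤ)) :
    pairNorm w ^ 2 = pairArray w (σ 2) (σ 3) ^ 2 + ((-pairArray w (σ 0) (σ 3)) ^ 2 +
      (-pairArray w (σ 1) (σ 3)) ^ 2 + pairArray w (σ 0) (σ 2) ^ 2 +
      pairArray w (σ 1) (σ 2) ^ 2) + pairArray w (σ 0) (σ 1) ^ 2 := by
  rw [pairNorm_sq, Fin.sum_univ_three, Fin.sum_univ_three]
  rcases perm_cases h01 h23 with ⟨e0, e1, e2, e3⟩ | ⟨e0, e1, e2, e3⟩ | ⟨e0, e1, e2, e3⟩ |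
      ⟨e0, e1, e2, e3⟩ | ⟨e0, e1, e2, e3⟩ | ⟨e0, e1, e2, e3⟩ <;>
    simp only [e0, e1, e2, e3, pairArray, Matrix.cons_val] <;> ring

/-- The chord is at most the arc. -/
theorem norm_sub_le_angle {V : Type*} [NormedAddCommGroup V] [InnerProductSpace ℝ V] {x y : V}
    (hx : ‖x‖ = 1) (hy : ‖y‖ = 1) : ‖x - y‖ ≤ InnerProductGeometry.angle x y := by
  refine abs_le_of_sq_le_sq' ?_ (InnerProductGeometry.angle_nonneg x y) |>.2
  have h1 := InnerProductGeometry.cos_angle x y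
  rw [hx, hy, mul_one, div_one] at h1
  have h2 := Real.one_sub_sq_div_two_le_cos (x := InnerProductGeometry.angle x y)
  rw [norm_sub_sq_real, hx, hy, ← h1]
  linarith

/-- The wedge product of two planes bounds the angle between them from below. For a unit vector `x`
of the first plane, `p = x ∧ y` with the contraction `y = ∑ₖ xₖ p k ·`; for `z` in the second
plane, `z ∧ P = 0`, so that `klein p P` is the product of `x - z`, `y` and `P`. -/
theorem abs_klein_le_minAngle {A B : Submodule ℝ (E 4)} (hA : Module.finrank ℝ A = 2)
    (hB : Module.finrank ℝ B = 2) {p P : Fin 4 → Fin 4 → ℝ} (hp : IsPluckerVector A p)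
    (hP : IsPluckerVector B P) (hp1 : ∀ k l, |p k l| ≤ 1) {N : ℝ} (hN : 0 < N)
    (hPN : ∀ k l, |P k l| ≤ N) : |klein p P| / (48 * N) ≤ minAngle A B := by
  have unit : ∀ L : Submodule ℝ (E 4), Module.finrank ℝ L = 2 → ∃ x ∈ L, ‖x‖ = 1 := by
    intro L hL
    have : Nontrivial L := Module.nontrivial_of_finrank_pos (R := ℝ) (by omega)
    obtain ⟨x, hx⟩ := exists_norm_eq L zero_le_one
    exact ⟨x, x.2, hx⟩
  obtain ⟨x₀, hx₀, hx₀'⟩ := unit A hA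
  obtain ⟨z₀, hz₀, hz₀'⟩ := unit B hB
  refine le_csInf ⟨_, x₀, hx₀, z₀, hz₀, hx₀', hz₀', rfl⟩ ?_
  rintro θ ⟨x, hx, z, hz, hx1, hz1, rfl⟩
  refine le_trans ?_ (norm_sub_le_angle hx1 hz1)
  obtain ⟨q₁, q₂, -, rfl, rfl⟩ := hp
  obtain ⟨b₁, b₂, -, rfl, rfl⟩ := hP
  obtain ⟨r, s, rfl⟩ := Submodule.mem_span_pair.1 hx
  obtain ⟨r', s', rfl⟩ := Submodule.mem_span_pair.1 hz
  set x := r • q₁ + s • q₂ with hxdef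
  set z := r' • b₁ + s' • b₂ with hzdef
  set y : Fin 4 → ℝ := fun l => ∑ k, x k * minors q₁ q₂ k l with hy
  have hxsq : ∑ k, x k ^ 2 = 1 := by
    have := EuclideanSpace.real_norm_sq_eq x
    rw [hx1, one_pow] at this
    exact this.symm
  have hxk : ∀ k, x k = r * q₁ k + s * q₂ k := fun k => by simp [hxdef]
  have hzk : ∀ k, z k = r' * b₁ k + s' * b₂ k := fun k => by simp [hzdef]
  have hcoord : ∀ (v : E 4) (k), |v k| ≤ ‖v‖ := fun v k => PiLp.norm_apply_le v k
  -- `x ∧ y = ‖x‖² p`, because `x` lies in the plane of `p`.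
  have hwedge : ∀ k l, minors q₁ q₂ k l = x k * y l - x l * y k := by
    intro k l
    have h1 : minors q₁ q₂ k l = (∑ m, x m ^ 2) * minors q₁ q₂ k l := by rw [hxsq, one_mul]
    rw [h1, hy]
    simp only [Fin.sum_univ_four, hxk, minors]
    ring
  have hyl : ∀ l, |y l| ≤ 4 := by
    intro l
    calc |y l| ≤ ∑ k, |x k * minors q₁ q₂ k l| := Finset.abs_sum_le_sum_abs _ _
      _ ≤ ∑ _k : Fin 4, (1 : ℝ) := Finset.sum_le_sum fun k _ => by
          rw [abs_mul]
          exact mul_le_one₀ ((hcoord x k).trans_eq hx1) (abs_nonneg _) (hp1 k l)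
      _ = 4 := by simp
  set m : Fin 4 → Fin 4 → ℝ := fun k l => (x - z) k * y l - (x - z) l * y k with hm
  have hmk : ∀ k l, |m k l| ≤ 8 * ‖x - z‖ := by
    intro k l
    have h : ∀ k l, |(x - z) k * y l| ≤ ‖x - z‖ * 4 := fun k l => by
      rw [abs_mul]
      exact mul_le_mul (hcoord _ k) (hyl l) (abs_nonneg _) (norm_nonneg _)
    linarith [abs_sub ((x - z) k * y l) ((x - z) l * y k), h k l, h l k]
  have hklein : klein (minors q₁ q₂) (minors b₁ b₂) = klein m (minors b₁ b₂) := by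
    rw [show minors q₁ q₂ = fun k l => x k * y l - x l * y k from
      funext fun k => funext fun l => hwedge k l]
    unfold klein
    simp only [ hm, PiLp.sub_apply, hzk, minors]
    ring
  have hterm : ∀ k l k' l', |m k l * minors b₁ b₂ k' l'| ≤ 8 * ‖x - z‖ * N := by
    intro k l k' l'
    rw [abs_mul]
    exact mul_le_mul (hmk k l) (hPN k' l') (abs_nonneg _) (by positivity)
  rw [div_le_iff₀ (by positivity), hklein, klein]
  have t1 := abs_le.1 (hterm 0 1 2 3)
  have t2 := abs_le.1 (hterm 0 2 1 3)
  have t3 := abs_le.1 (hterm 0 3 1 2)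
  have t4 := abs_le.1 (hterm 1 2 0 3)
  have t5 := abs_le.1 (hterm 1 3 0 2)
  have t6 := abs_le.1 (hterm 2 3 0 1)
  rw [abs_le]
  constructor <;> nlinarith

/-- The height of a rational plane is the norm of an integer Pluecker vector. -/
theorem exists_pair_of_isRational {B : Submodule ℝ (E 4)} (hB : Module.finrank ℝ B = 2)
    (hr : IsRational B) : ∃ w : (Fin 3 → ℤ) × (Fin 3 → ℤ), w ≠ 0 ∧ ∑ i, w.1 i * w.2 i = 0 ∧
      height B = pairNorm w ∧ IsPluckerVector B (pairArray w) := by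
  have hrank : Module.finrank ℤ (integerLattice B) = 2 := hr.trans hB
  set b := Module.finBasisOfFinrankEq ℤ (integerLattice B) hrank with hb
  choose n hn using fun i => (b i).2.2
  set m : Fin 4 → Fin 4 → ℤ := fun k l => n 0 k * n 1 l - n 0 l * n 1 k with hm
  have hminors : ∀ k l, minors (b 0 : E 4) (b 1) k l = m k l := by
    intro k l
    simp [minors, hn, hm]
  set w : (Fin 3 → ℤ) × (Fin 3 → ℤ) := (![m 0 1, m 0 2, m 0 3], ![m 2 3, -m 1 3, m 1 2]) with hw
  have harray : pairArray w = minors (b 0 : E 4) (b 1) := by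
    ext k l
    rw [hminors]
    fin_cases k <;> fin_cases l <;> simp [pairArray, hw, hm]
  have hw0 : w ≠ 0 := by
    intro h0
    have hmz : ∀ k l, m k l = 0 := by
      intro k l
      have h1 : ((m k l : ℤ) : ℝ) = 0 := by
        rw [← hminors, ← harray, h0]
        fin_cases k <;> fin_cases l <;> simp [pairArray]
      exact_mod_cast h1
    obtain ⟨k, hk⟩ : ∃ k, n 0 k ≠ 0 := by
      by_contra! h
      refine b.ne_zero 0 (Subtype.ext ?_)
      ext k
      rw [hn, h k]
      simp
    -- If all minors vanish, the two basis vectors satisfy an integral linear relation.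
    have hrel : n 1 k • b 0 + (-n 0 k) • b 1 = 0 := by
      apply Subtype.ext
      ext l
      have := hmz k l
      simp only [hm] at this
      have h2 : ((n 1 k * n 0 l - n 0 k * n 1 l : ℤ) : ℝ) = 0 := by
        exact_mod_cast (by linarith : n 1 k * n 0 l - n 0 k * n 1 l = 0)
      push_cast at h2
      simp [hn]
      linarith
    have hli := LinearIndependent.pair_iff.1
      (b.linearIndependent.comp ![0, 1] (by decide) |> fun h => by
        have : (⇑b ∘ ![0, 1]) = ![b 0, b 1] := by ext i; fin_cases i <;> rfl
        rwa [this] at h)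
    exact hk (neg_eq_zero.1 (hli _ _ hrel).2)
  have hli : LinearIndependent ℝ ![(b 0 : E 4), (b 1 : E 4)] := by
    rw [LinearIndependent.pair_iff]
    intro r s hrs
    have hrs' : ∀ k, r * (b 0 : E 4) k + s * (b 1 : E 4) k = 0 := fun k => by
      have := congrArg (fun v : E 4 => v k) hrs
      simpa using this
    obtain ⟨k, l, hkl⟩ : ∃ k l, minors (b 0 : E 4) (b 1) k l ≠ 0 := by
      by_contra! h
      have h0 : pairArray w = 0 := by rw [harray]; ext k l; exact h k l
      have hle := one_le_pairNorm hw0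
      have hsq := pairNorm_sq w
      have e1 := congrFun (congrFun h0 0) 1
      have e2 := congrFun (congrFun h0 0) 2
      have e3 := congrFun (congrFun h0 0) 3
      have e4 := congrFun (congrFun h0 2) 3
      have e5 := congrFun (congrFun h0 3) 1
      have e6 := congrFun (congrFun h0 1) 2
      simp only [pairArray, Matrix.cons_val, Pi.zero_apply] at e1 e2 e3 e4 e5 e6
      rw [Fin.sum_univ_three, Fin.sum_univ_three, e1, e2, e3, e4, e5, e6] at hsq
      nlinarith
    have h1 : r * minors (b 0 : E 4) (b 1) k l = 0 := by
      simp only [minors]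
      linear_combination (b 1 : E 4) l * hrs' k - (b 1 : E 4) k * hrs' l
    have h2 : s * minors (b 0 : E 4) (b 1) k l = 0 := by
      simp only [minors]
      linear_combination (b 0 : E 4) k * hrs' l - (b 0 : E 4) l * hrs' k
    exact ⟨(mul_eq_zero.1 h1).resolve_right hkl, (mul_eq_zero.1 h2).resolve_right hkl⟩
  refine ⟨w, hw0, ?_, ?_, b 0, b 1, hli, ?_, harray⟩
  · simp only [hw, hm, Fin.sum_univ_three, Matrix.cons_val]
    ring
  · rw [height_eq B b, pairNorm]
    congr 1
    rw [Matrix.det_fin_two]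
    simp only [Matrix.gram_apply, EuclideanSpace.inner_eq_star_dotProduct, dotProduct,
      Fin.sum_univ_four, Fin.sum_univ_three, hw, hm, Matrix.cons_val, Pi.star_apply,
      star_trivial, hn]
    push_cast
    ring
  · refine Submodule.eq_of_le_of_finrank_eq ?_ ?_
    · rw [Submodule.span_le]
      rintro v (rfl | rfl)
      · exact (b 0).2.1
      · exact (b 1).2.1
    · have := finrank_span_eq_card hli
      rw [hB]
      rwa [Matrix.range_cons_cons_empty, Fintype.card_fin] at this

end Planes

/-! ### The Borel–Cantelli argument -/

namespace Planes

open MeasureTheory Set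
open scoped ENNReal

/-- Condensation: the block `4^k ≤ j < 4^(k+1)` of the series contributes at least
`16^k * ω (2^(k+1))`. -/
theorem summable_pow_mul_dyadic {ω : ℝ → ℝ} (h0 : ∀ x, 1 ≤ x → 0 ≤ ω x)
    (hanti : AntitoneOn ω (Set.Ici 1))
    (hsum : Summable fun j : ℕ => ((j : ℝ) + 1) * ω (Real.sqrt ((j : ℝ) + 1))) :
    Summable fun k : ℕ => (16 : ℝ) ^ k * ω (2 ^ k) := by
  set f : ℕ → ℝ := fun j => ((j : ℝ) + 1) * ω (Real.sqrt ((j : ℝ) + 1)) with hf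
  have hsqrt : ∀ j : ℕ, 1 ≤ Real.sqrt ((j : ℝ) + 1) := fun j => by
    rw [Real.one_le_sqrt]
    linarith [Nat.cast_nonneg (α := ℝ) j]
  have hf0 : ∀ j, 0 ≤ f j := fun j => mul_nonneg (by positivity) (h0 _ (hsqrt j))
  have hpow : ∀ k : ℕ, (1 : ℝ) ≤ 2 ^ k := fun k => one_le_pow₀ one_le_two
  have hblock : ∀ n : ℕ, (16 : ℝ) ^ n * ω (2 ^ (n + 1)) ≤
      ∑ j ∈ Finset.Ico (4 ^ n) (4 ^ (n + 1)), f j := by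
    intro n
    have hω := h0 _ (hpow (n + 1))
    have h1 : ∀ j ∈ Finset.Ico (4 ^ n) (4 ^ (n + 1)), (4 : ℝ) ^ n * ω (2 ^ (n + 1)) ≤ f j := by
      intro j hj
      rw [Finset.mem_Ico] at hj
      have hj1 : (4 : ℝ) ^ n ≤ j := by exact_mod_cast hj.1
      have hj2 : (j : ℝ) + 1 ≤ 4 ^ (n + 1) := by exact_mod_cast hj.2
      refine mul_le_mul (by linarith) (hanti (hsqrt j) (hpow (n + 1)) ?_) hω (by positivity)
      rw [Real.sqrt_le_left (by positivity), ← pow_mul, mul_comm, pow_mul]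
      norm_num
      exact hj2
    have h2 := Finset.card_nsmul_le_sum _ _ _ h1
    rw [Nat.card_Ico, nsmul_eq_mul] at h2
    refine le_trans ?_ h2
    have h3 : ((4 ^ (n + 1) - 4 ^ n : ℕ) : ℝ) = 3 * 4 ^ n := by
      rw [Nat.cast_sub (Nat.pow_le_pow_right (by norm_num) (Nat.le_add_right n 1))]
      push_cast
      ring
    rw [h3, show (16 : ℝ) ^ n = 4 ^ n * 4 ^ n by rw [← mul_pow]; norm_num]
    have : 0 ≤ (4 : ℝ) ^ n * 4 ^ n * ω (2 ^ (n + 1)) := by positivity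
    linarith
  have hpartial : ∀ n : ℕ, ∑ k ∈ Finset.range n, (16 : ℝ) ^ k * ω (2 ^ (k + 1)) ≤
      ∑ j ∈ Finset.range (4 ^ n), f j := by
    intro n
    induction n with
    | zero => simpa using hf0 0
    | succ n ih =>
      have hsplit := Finset.sum_Ico_consecutive f (Nat.zero_le (4 ^ n))
        (Nat.pow_le_pow_right (by norm_num) (Nat.le_add_right n 1))
      simp only [← Finset.range_eq_Ico] at hsplit
      rw [Finset.sum_range_succ, ← hsplit]
      exact add_le_add ih (hblock n)
  have hS : Summable fun k : ℕ => (16 : ℝ) ^ k * ω (2 ^ (k + 1)) :=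
    summable_of_sum_range_le (fun k => mul_nonneg (by positivity) (h0 _ (hpow _)))
      fun n => (hpartial n).trans (hsum.sum_le_tsum _ fun j _ => hf0 j)
  rw [← summable_nat_add_iff 1]
  refine (hS.mul_left 16).congr fun k => ?_
  rw [pow_succ (16 : ℝ) k]
  ring

/-- The coefficient vector of `chartForm σ w` has length `pairNorm w`, so the volume bound for
determinantal forms applies uniformly in `w`. -/
theorem exists_volume_chartForm_lt_le : ∃ K : ℝ≥0∞, K ≠ ∞ ∧
    ∀ (σ : Equiv.Perm (Fin 4)), σ 0 < σ 1 → σ 2 < σ 3 →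
      ∀ w : (Fin 3 → ℤ) × (Fin 3 → ℤ), w ≠ 0 → ∀ δ : ℝ, 0 ≤ δ →
        volume {x ∈ cube 4 | |chartForm σ w x| < δ * pairNorm w} ≤ K * ENNReal.ofReal δ := by
  obtain ⟨K, hK, h⟩ := exists_volume_detForm_lt_le
  exact ⟨K, hK, fun σ h01 h23 w hw δ hδ => h _ _ _ _ _ (zero_lt_one.trans_le (one_le_pairNorm hw))
    hδ (pairNorm_sq_eq_chartForm h01 h23 w)⟩

theorem ae_chartForm_ne_zero {σ : Equiv.Perm (Fin 4)} (h01 : σ 0 < σ 1) (h23 : σ 2 < σ 3) :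
    ∀ᵐ x : Fin 4 → ℝ, ∀ w : (Fin 3 → ℤ) × (Fin 3 → ℤ), w ≠ 0 → x ∈ cube 4 →
      chartForm σ w x ≠ 0 := by
  obtain ⟨K, hK, h⟩ := exists_volume_chartForm_lt_le
  rw [ae_all_iff]
  intro w
  by_cases hw : w = 0
  · exact Filter.Eventually.of_forall fun x h => (h hw).elim
  have hN := zero_lt_one.trans_le (one_le_pairNorm hw)
  have hlim : Filter.Tendsto (fun n : ℕ => K * ENNReal.ofReal (1 / ((n : ℝ) + 1))) Filter.atTop
      (nhds 0) := by
    have := ENNReal.Tendsto.const_mul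
      (ENNReal.tendsto_ofReal tendsto_one_div_add_atTop_nhds_zero_nat) (Or.inr hK)
    simpa using this
  have hnull : volume {x ∈ cube 4 | chartForm σ w x = 0} = 0 := by
    refine le_antisymm (ge_of_tendsto' hlim fun n => ?_) zero_le
    refine (measure_mono fun x hx => ?_).trans (h σ h01 h23 w hw _ (by positivity))
    refine ⟨hx.1, ?_⟩
    rw [hx.2, abs_zero]
    positivity
  rw [← compl_mem_ae_iff] at hnull
  filter_upwards [hnull] with x hx _ hxc h0
  exact hx ⟨hxc, h0⟩

/-- The points of the cube at which the form of some nonzero integer point `w` of the Pluecker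
quadric with entries at most `2^(k+1)` is smaller than `ω (2^k) * |w|`. -/
def badSet (σ : Equiv.Perm (Fin 4)) (ω : ℝ → ℝ) (k : ℕ) : Set (Fin 4 → ℝ) :=
  ⋃ w ∈ (orthogonalPairs (2 ^ (k + 1))).erase 0,
    {x ∈ cube 4 | |chartForm σ w x| < ω (2 ^ k) * pairNorm w}

/-- There are `O(16^k)` integer points with entries at most `2^(k+1)`, and each contributes volume
`O(ω (2^k))`. -/
theorem tsum_volume_badSet_ne_top {σ : Equiv.Perm (Fin 4)} (h01 : σ 0 < σ 1) (h23 : σ 2 < σ 3)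
    {ω : ℝ → ℝ} (h0 : ∀ x, 1 ≤ x → 0 ≤ ω x)
    (hsum : Summable fun k : ℕ => (16 : ℝ) ^ k * ω (2 ^ k)) :
    ∑' k, volume (badSet σ ω k) ≠ ∞ := by
  obtain ⟨K, hK, h⟩ := exists_volume_chartForm_lt_le
  have hpow : ∀ k : ℕ, (1 : ℝ) ≤ 2 ^ k := fun k => one_le_pow₀ one_le_two
  have hle : ∀ k, volume (badSet σ ω k) ≤
      K * ENNReal.ofReal (927 * 16 * (16 ^ k * ω (2 ^ k))) := by
    intro k
    have hω := h0 _ (hpow k)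
    calc volume (badSet σ ω k)
        ≤ ∑ w ∈ (orthogonalPairs (2 ^ (k + 1))).erase 0,
            volume {x ∈ cube 4 | |chartForm σ w x| < ω (2 ^ k) * pairNorm w} :=
          measure_biUnion_finset_le _ _
      _ ≤ ∑ _w ∈ (orthogonalPairs (2 ^ (k + 1))).erase 0, K * ENNReal.ofReal (ω (2 ^ k)) :=
          Finset.sum_le_sum fun w hw => h σ h01 h23 w (Finset.ne_of_mem_erase hw) _ hω
      _ ≤ (orthogonalPairs (2 ^ (k + 1))).card * (K * ENNReal.ofReal (ω (2 ^ k))) := by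
          rw [Finset.sum_const, nsmul_eq_mul]
          gcongr
          exact Finset.erase_subset _ _
      _ = K * ENNReal.ofReal ((orthogonalPairs (2 ^ (k + 1))).card * ω (2 ^ k)) := by
          rw [ENNReal.ofReal_mul (Nat.cast_nonneg _), ENNReal.ofReal_natCast]
          ring
      _ ≤ K * ENNReal.ofReal (927 * 16 * (16 ^ k * ω (2 ^ k))) := by
          gcongr K * ENNReal.ofReal ?_
          have h1 := card_orthogonalPairs_le (X := 2 ^ (k + 1)) Nat.one_le_two_pow
          have h2 : (((2 ^ (k + 1) : ℕ) : ℝ)) ^ 4 = 16 * 16 ^ k := by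
            push_cast
            rw [← pow_mul, mul_comm, pow_mul, pow_succ]
            norm_num
            ring
          rw [h2] at h1
          calc _ ≤ 927 * (16 * 16 ^ k) * ω (2 ^ k) := by gcongr
            _ = _ := by ring
  refine ne_top_of_le_ne_top ?_ (ENNReal.tsum_le_tsum hle)
  rw [ENNReal.tsum_mul_left, ← ENNReal.ofReal_tsum_of_nonneg _ (hsum.mul_left _)]
  · exact ENNReal.mul_ne_top hK ENNReal.ofReal_ne_top
  · exact fun k => mul_nonneg (by norm_num) (mul_nonneg (by positivity) (h0 _ (hpow k)))

/-- For almost every point of the chart, the forms of the integer Pluecker vectors `w` are bounded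
below by a multiple of `ω(|w|) |w|`. -/
theorem ae_exists_le_abs_chartForm {σ : Equiv.Perm (Fin 4)} (h01 : σ 0 < σ 1) (h23 : σ 2 < σ 3)
    {ω : ℝ → ℝ} (h0 : ∀ x, 1 ≤ x → 0 ≤ ω x) (hanti : AntitoneOn ω (Set.Ici 1))
    (hsum : Summable fun j : ℕ => ((j : ℝ) + 1) * ω (Real.sqrt ((j : ℝ) + 1))) :
    ∀ᵐ x : Fin 4 → ℝ, x ∈ cube 4 → ∃ C : ℝ, 0 < C ∧ ∀ w : (Fin 3 → ℤ) × (Fin 3 → ℤ), w ≠ 0 →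
      ∑ i, w.1 i * w.2 i = 0 → C * ω (pairNorm w) * pairNorm w ≤ |chartForm σ w x| := by
  filter_upwards [ae_chartForm_ne_zero h01 h23, ae_eventually_notMem
    (tsum_volume_badSet_ne_top h01 h23 h0 (summable_pow_mul_dyadic h0 hanti hsum))]
    with x hx1 hx2 hx
  obtain ⟨k₀, hk₀⟩ := Filter.eventually_atTop.1 hx2
  -- The finitely many Pluecker vectors of small norm contribute a positive minimum.
  set S := (orthogonalPairs (2 ^ k₀)).erase 0 with hS
  obtain ⟨c, hc, hcS⟩ : ∃ c : ℝ, 0 < c ∧ ∀ w ∈ S, c ≤ |chartForm σ w x| := by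
    rcases S.eq_empty_or_nonempty with h | h
    · exact ⟨1, one_pos, by simp [h]⟩
    · obtain ⟨w, hw, hmin⟩ := S.exists_min_image (fun w => |chartForm σ w x|) h
      exact ⟨_, abs_pos.2 (hx1 w (Finset.ne_of_mem_erase hw) hx), hmin⟩
  have hω1 := h0 1 le_rfl
  set D : ℝ := (ω 1 + 1) * 2 ^ k₀ with hD
  have hD0 : 0 < D := by positivity
  refine ⟨min 1 (c / D), lt_min one_pos (div_pos hc hD0), fun w hw hq => ?_⟩
  have hN := one_le_pairNorm hw
  have hωN := h0 _ hN
  have hN0 := zero_lt_one.trans_le hN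
  rcases lt_or_ge (pairNorm w) (2 ^ k₀) with hlt | hge
  · have hwS : w ∈ S := Finset.mem_erase.2
      ⟨hw, mem_orthogonalPairs_of_pairNorm_lt (by push_cast; exact hlt) hq⟩
    have hle : ω (pairNorm w) ≤ ω 1 + 1 :=
      (hanti (Set.mem_Ici.2 le_rfl) (Set.mem_Ici.2 hN) hN).trans (by linarith)
    calc min 1 (c / D) * ω (pairNorm w) * pairNorm w
        ≤ c / D * (ω 1 + 1) * 2 ^ k₀ := by
          gcongr
          exact min_le_right _ _
      _ = c := by
          rw [hD]
          field_simp
      _ ≤ _ := hcS w hwS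
  · obtain ⟨k, hk1, hk2⟩ := exists_nat_pow_near hN one_lt_two
    have hk : k₀ ≤ k := by
      by_contra! hlt
      have : (2 : ℝ) ^ (k + 1) ≤ 2 ^ k₀ := pow_le_pow_right₀ one_le_two hlt
      linarith
    have hnot := hk₀ k hk
    have hwm : w ∈ (orthogonalPairs (2 ^ (k + 1))).erase 0 := Finset.mem_erase.2
      ⟨hw, mem_orthogonalPairs_of_pairNorm_lt (by push_cast; exact hk2) hq⟩
    have hlow : ω (2 ^ k) * pairNorm w ≤ |chartForm σ w x| := by
      by_contra! hlt
      exact hnot (Set.mem_biUnion hwm ⟨hx, hlt⟩)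
    have h1 : ω (pairNorm w) ≤ ω (2 ^ k) :=
      hanti (Set.mem_Ici.2 (one_le_pow₀ one_le_two)) (Set.mem_Ici.2 hN) hk1
    calc min 1 (c / D) * ω (pairNorm w) * pairNorm w ≤ 1 * ω (2 ^ k) * pairNorm w := by
          gcongr
          exact min_le_left _ _
      _ ≤ _ := by rwa [one_mul]

theorem nu_mem_cube {σ : Equiv.Perm (Fin 4)} {p : Fin 4 → Fin 4 → ℝ} (hp : ∀ k l, |p k l| ≤ 1) :
    nu σ p ∈ cube 4 := by
  intro i _
  refine abs_le.1 ?_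
  fin_cases i <;> simp [nu, hp]

theorem almostEveryPlane_le_minAngle {ω : ℝ → ℝ} (h0 : ∀ x, 1 ≤ x → 0 ≤ ω x)
    (hanti : AntitoneOn ω (Set.Ici 1))
    (hsum : Summable fun j : ℕ => ((j : ℝ) + 1) * ω (Real.sqrt ((j : ℝ) + 1))) :
    AlmostEveryPlane fun A => ∃ C : ℝ, 0 < C ∧ ∀ B : Submodule ℝ (E 4),
      Module.finrank ℝ B = 2 → IsRational B → C * ω (height B) ≤ minAngle A B := by
  intro σ h01 h23
  refine measure_mono_null ?_ (mem_ae_iff.1 (ae_exists_le_abs_chartForm h01 h23 h0 hanti hsum))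
  rintro _ ⟨p, ⟨hpW, A, ⟨hA, hnot⟩, hp⟩, rfl⟩ hgood
  obtain ⟨C, hC, hle⟩ := hgood (nu_mem_cube hpW.2.2.1)
  refine hnot ⟨C / 48, by positivity, fun B hB hr => ?_⟩
  obtain ⟨w, hw, hq, hheight, hP⟩ := exists_pair_of_isRational hB hr
  have hN := zero_lt_one.trans_le (one_le_pairNorm hw)
  refine le_trans ?_ (abs_klein_le_minAngle hA hB hp hP hpW.2.2.1 hN (abs_pairArray_le w))
  rw [abs_klein_eq_abs_chartForm h01 h23 hpW, hheight, le_div_iff₀ (by positivity)]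
  calc _ = C * ω (pairNorm w) * pairNorm w := by ring
    _ ≤ _ := hle w hw hq

theorem summable_mul_sqrt_rpow {ε : ℝ} (hε : 0 < ε) :
    Summable fun j : ℕ => ((j : ℝ) + 1) * Real.sqrt ((j : ℝ) + 1) ^ (-4 - ε) := by
  have h : Summable fun j : ℕ => ((j + 1 : ℕ) : ℝ) ^ (-1 - ε / 2) :=
    (summable_nat_add_iff 1).2 (Real.summable_nat_rpow.2 (by linarith))
  refine h.congr fun j => ?_
  have hj : (0 : ℝ) < j + 1 := by positivity
  push_cast
  rw [Real.sqrt_eq_rpow, ← Real.rpow_mul hj.le]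
  nth_rw 2 [← Real.rpow_one ((j : ℝ) + 1)]
  rw [← Real.rpow_add hj]
  congr 1
  ring

end Planes

theorem mainTheorem1 :
    (∀ ω : ℝ → ℝ,
      (∀ x, 1 ≤ x → 0 ≤ ω x) →
      AntitoneOn ω (Set.Ici 1) →
      Summable (fun j : ℕ => ((j : ℝ) + 1) * ω (Real.sqrt ((j : ℝ) + 1))) →
      Planes.AlmostEveryPlane fun A =>
        ∃ C : ℝ, 0 < C ∧ ∀ B : Submodule ℝ (Planes.E 4),
          Module.finrank ℝ B = 2 → Planes.IsRational B →
            C * ω (Planes.height B) ≤ Planes.minAngle A B) ∧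
    (∀ ε : ℝ, 0 < ε →
      Planes.AlmostEveryPlane fun A =>
        ∃ C : ℝ, 0 < C ∧ ∀ B : Submodule ℝ (Planes.E 4),
          Module.finrank ℝ B = 2 → Planes.IsRational B →
            C * (Planes.height B) ^ (-4 - ε) ≤ Planes.minAngle A B) := by
  refine ⟨fun ω h0 hanti hsum => Planes.almostEveryPlane_le_minAngle h0 hanti hsum,
    fun ε hε => Planes.almostEveryPlane_le_minAngle (ω := fun x => x ^ (-4 - ε)) ?_ ?_
      (Planes.summable_mul_sqrt_rpow hε)⟩
  · intro x hx
    positivity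
  · intro x hx y _ hxy
    exact Real.rpow_le_rpow_of_nonpos (zero_lt_one.trans_le hx) hxy (by linarith)
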